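/- **Corollary.** Call a point of $\mathbb R^2$ integer if both coordinates are integers. The integer length of a segment $AB$ with distinct integer endpoints is its Euclidean length divided by the minimal Euclidean length of a nonzero integer vector contained in it. A one-dimensional continued fraction (in the sense of Klein) is an unordered pair of distinct straight lines through the origin of $\mathbb R^2$. The two lines cut the plane into four open orthants; the sail of an orthant is the boundary of the convex hull of all nonzero integer points of its closure, and a face (edge) of a sail is a nondegenerate compact segment that is the intersection of the sail with a straight line. Let $CF_1$ be the space of all such continued fractions, $FCF_1$ the space of ordered pairs of distinct lines through the origin, and $p:FCF_1\to CF_1$ the natural two-sheeted projection. For a straight line $l$ not passing through the origin, with a Euclidean coordinate on it, let $\mu_{\omega}$ be the (Möbius) measure on $FCF_1$ which is $$\frac{dx\,dy}{|x-y|^2}$$ in the coordinates $(x,y)$ of the intersection points of $l$ with the first and the second line of the pair, and for which the set of pairs containing a line parallel to $l$ is null. Let $\mu_1=\tfrac12\,p_*\mu_{\omega}$ be its projection to $CF_1$. For a segment $F$ with integer endpoints let $CF_1(F)\subset CF_1$ be the set of continued fractions that contain $F$ as a face of one of their sails; the relative frequency of $F$ is $\mu_1(CF_1(F))$. For positive integers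 $n,k$ let $P_n(k)$ be the Lebesgue measure of the set of all $\alpha\in[0,1]$ whose ordinary continued fraction $\alpha=[a_0,a_1,a_2,\dots]$ has $a_n=k$. Then $$\ln 2=\int_{-1}^{0}\int_{1}^{+\infty}\frac{dx\,dy}{(x-y)^2},$$ and for every positive integer $k$: 1. the limit $P(k)=\lim_{n\to\infty}P_n(k)$ (the Gauss–Kuzmin frequency of $k$) exists; 2. there is a segment with integer endpoints and of integer length $k$ that is a face of some one-dimensional continued fraction; 3. for every choice of $l$ and every segment $F$ with integer endpoints and of integer length $k$ that is a face of some one-dimensional continued fraction, the relative frequency $\mu_1(\text{“}k\text{”}):=\mu_1(CF_1(F))$ satisfies $$\mu_1(\text{“}k\text{”})=\ln 2\cdot P(k).$$ -/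

import Mathlib

namespace KleinCF

/-! ### Digits of ordinary continued fractions -/

/-- The Lebesgue measure of the set of all `α ∈ [0, 1]` whose ordinary continued fraction
`α = [a₀, a₁, a₂, …]` has `a_{n+1} = k`.  (Entry `n` of the sequence of partial denominators
is `a_{n+1}`; the rationals, whose expansions are finite and not unique, form a null set.) -/
noncomputable def digitProbability (n k : ℕ) : ℝ :=
  MeasureTheory.volume.real
    {α : ℝ | α ∈ Set.Icc (0 : ℝ) 1 ∧ (GenContFract.of α).partDens.get? n = some (k : ℝ)}

/-- `P` is the (Gauss–Kuzmin) frequency of the digit `k`: the measures of the sets of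
`α ∈ [0, 1]` with `n`-th digit `k` converge to `P` as `n → ∞`. -/
def IsDigitFrequency (k : ℕ) (P : ℝ) : Prop :=
  Filter.Tendsto (fun n : ℕ => digitProbability n k) Filter.atTop (nhds P)

/-! ### Integer geometry of the plane -/

/-- The plane with its standard Euclidean metric. -/
abbrev Plane : Type := EuclideanSpace ℝ (Fin 2)

/-- Points with integer coordinates. -/
def IsIntegerPoint (x : Plane) : Prop := ∀ i, ∃ m : ℤ, x i = (m : ℝ)

/-- The integer length of the segment `AB`: its Euclidean length divided by the minimal
Euclidean length of a (nonzero) integer vector contained in the segment. -/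
noncomputable def integerLength (A B : Plane) : ℝ :=
  dist A B / sInf {r : ℝ | ∃ P ∈ segment ℝ A B, ∃ Q ∈ segment ℝ A B,
    IsIntegerPoint P ∧ IsIntegerPoint Q ∧ P ≠ Q ∧ r = dist P Q}

/-! ### Sails and their edges -/

/-- The closed cone spanned by `v` and `w`. -/
def closedCone (v w : Plane) : Set Plane :=
  {z | ∃ s t : ℝ, 0 ≤ s ∧ 0 ≤ t ∧ z = s • v + t • w}

/-- The sail of the cone spanned by `v` and `w`: the boundary of the convex hull of all
integer points of the closed cone except the origin. -/
def sail (v w : Plane) : Set Plane :=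
  frontier (convexHull ℝ {z | z ∈ closedCone v w ∧ IsIntegerPoint z ∧ z ≠ 0})

/-- `F` is a one-dimensional face of `S`: the intersection of `S` with an affine line, and a
one-dimensional disc (in a line this means a nondegenerate compact segment). -/
def IsEdge (S F : Set Plane) : Prop :=
  (∃ H : AffineSubspace ℝ Plane, Module.finrank ℝ H.direction = 1 ∧ F = (H : Set Plane) ∩ S) ∧
    ∃ A B : Plane, A ≠ B ∧ F = segment ℝ A B

/-! ### The spaces of (framed) one-dimensional continued fractions -/

/-- The projective line of all straight lines through the origin of the plane. -/
abbrev Line : Type := Projectivization ℝ Plane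

/-- The σ-algebra of the projective line, as a quotient of the nonzero vectors: a set of lines
is measurable iff the set of nonzero vectors spanning its members is Borel.  (It is the Borel
σ-algebra of the projective line.) -/
instance instMeasurableSpaceLine : MeasurableSpace Line :=
  inferInstanceAs (MeasurableSpace (Quotient (projectivizationSetoid ℝ Plane)))

/-- Framed continued fractions: ordered pairs of independent lines. -/
abbrev FramedCF : Type := {c : Line × Line // c.1 ≠ c.2}

/-- Forgetting the order of the two lines. -/
def forgetOrder : Setoid FramedCF where
  r c d := c.1 = d.1 ∨ c.1 = d.1.swap
  iseqv :=
    { refl := fun _ => Or.inl rfl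
      symm := by
        rintro c d (h | h)
        · exact Or.inl h.symm
        · exact Or.inr (by rw [h, Prod.swap_swap])
      trans := by
        rintro c d e (h | h) (h' | h')
        · exact Or.inl (h.trans h')
        · exact Or.inr (h.trans h')
        · exact Or.inr (by rw [h, h'])
        · exact Or.inl (by rw [h, h', Prod.swap_swap]) }

/-- One-dimensional continued fractions: unordered pairs of independent lines, with the
quotient σ-algebra. -/
abbrev CF : Type := Quotient forgetOrder

/-- The natural projection of framed continued fractions to continued fractions. -/
def proj (c : FramedCF) : CF := Quotient.mk forgetOrder c

/-- `CF₁(F)`: the set of the continued fractions that contain `F` as a one-dimensional face, i.e.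
`F` is an edge of the sail of one of the four orthants cut out by the two lines.  These orthants
are the cones spanned by a nonzero vector of the first and one of the second line. -/
def withEdge (F : Set Plane) : Set CF :=
  {z | ∃ c : FramedCF, proj c = z ∧ ∃ v w : Plane,
    v ∈ c.1.1.submodule ∧ v ≠ 0 ∧ w ∈ c.1.2.submodule ∧ w ≠ 0 ∧ IsEdge (sail v w) F}

/-! ### The Möbius measure -/

/-- A straight line in the plane that misses the origin, with a Euclidean coordinate `t` on it:
`t` is the coordinate of the point `base + t • dir`. -/
structure CoordLine where
  base : Plane
  dir : Plane
  norm_dir : ‖dir‖ = 1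
  avoids_origin : ∀ t : ℝ, base + t • dir ≠ 0

/-- The line through the origin and the point of `l` with coordinate `t`. -/
noncomputable def CoordLine.lineThrough (l : CoordLine) (t : ℝ) : Line :=
  Projectivization.mk ℝ (l.base + t • l.dir) (l.avoids_origin t)

theorem CoordLine.lineThrough_injective (l : CoordLine) :
    Function.Injective l.lineThrough := by
  intro x y h
  obtain ⟨a, ha⟩ := (Projectivization.mk_eq_mk_iff' ℝ _ _ _ _).1 h
  by_contra hxy
  by_cases h1 : a = 1
  · subst h1
    have h2 : (x - y) • l.dir = 0 := by
      rw [one_smul] at ha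
      rw [sub_smul, sub_eq_zero]
      exact (add_left_cancel ha).symm
    rcases smul_eq_zero.1 h2 with h3 | h3
    · exact hxy (sub_eq_zero.1 h3)
    · have := l.norm_dir
      rw [h3] at this
      simp at this
  · have h2 : a - 1 ≠ 0 := sub_ne_zero.2 h1
    apply l.avoids_origin ((a - 1)⁻¹ * (a * y - x))
    have h3 : (a - 1) • (l.base + ((a - 1)⁻¹ * (a * y - x)) • l.dir) = 0 := by
      rw [smul_add, smul_smul, mul_inv_cancel_left₀ h2]
      have : (a - 1) • l.base + (a * y - x) • l.dir
          = a • (l.base + y • l.dir) - (l.base + x • l.dir) := by module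
      rw [this, ha, sub_self]
    exact (smul_eq_zero.1 h3).resolve_left h2

/-- The plane minus its diagonal: the range of the coordinates `(x, y)` of a chart. -/
abbrev OffDiag : Type := {q : ℝ × ℝ // q.1 ≠ q.2}

/-- The inverse of the chart of framed continued fractions given by `l`: to `(x, y)` it assigns
the pair of lines that meet `l` at the points with coordinates `x` and `y`. -/
noncomputable def CoordLine.framedOfCoords (l : CoordLine) (q : OffDiag) : FramedCF :=
  ⟨(l.lineThrough q.1.1, l.lineThrough q.1.2), fun h => q.2 (l.lineThrough_injective h)⟩

/-- The measure of the form `dx ∧ dy / |x - y|²` off the diagonal. -/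
noncomputable def formMeasure : MeasureTheory.Measure OffDiag :=
  (MeasureTheory.Measure.comap Subtype.val
      (MeasureTheory.volume : MeasureTheory.Measure (ℝ × ℝ))).withDensity
    (fun q => ENNReal.ofReal (1 / |q.1.1 - q.1.2| ^ 2))

/-- The Möbius measure on framed continued fractions: it is `dx dy / |x - y|²` in the
coordinates of the chart given by `l`.  The complement of the chart (one of the two lines is
parallel to `l`) is a union of two curves, hence null for the measure of a volume form. -/
noncomputable def framedMoebiusMeasure (l : CoordLine) : MeasureTheory.Measure FramedCF :=
  MeasureTheory.Measure.map l.framedOfCoords formMeasure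

/-- The Möbius measure on continued fractions: the projection of the measure on framed continued
fractions, divided by the number `2!` of sheets. -/
noncomputable def moebiusMeasure (l : CoordLine) : MeasureTheory.Measure CF :=
  (2 : ENNReal)⁻¹ • MeasureTheory.Measure.map proj (framedMoebiusMeasure l)

/-- The relative frequency of `F`: the Möbius measure of the set of the continued fractions that
contain `F` as a face. -/
noncomputable def relativeFrequency (l : CoordLine) (F : Set Plane) : ENNReal :=
  moebiusMeasure l (withEdge F)

end KleinCF

namespace KleinCF

open MeasureTheory Set Filter Topology

/-! ### The Gauss–Kuzmin operator -/

/-! Both sides are computed in closed form: the limit is P(k) = log((k+1)²/(k(k+2))) / log 2, and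
every edge of integer length k has relative frequency log((k+1)²/(k(k+2))).

Frequency. Write the density of the n-th remainder under the Gauss map as g_n(x)/(1+x), with g_0(x)
= 1+x. Then g_{n+1} = `gaussOp` g_n averages values of g_n with weights of sum 1. The averaging
turns increasing functions into decreasing ones (`antitoneOn_gaussOp`), and comparison with the
explicit function `refFun` shows that the bound on the oscillation halves at every step
(`monotoneOn_of_gaussOp`). Hence g_n flattens exponentially fast, and total mass 1 forces the limit
1/log 2. A digit k corresponds to the interval (1/(k+1), 1/k] of remainders, whose Gauss measure is
P(k).

Edges. Let the segment from A to A + ke, with e primitive, be an edge. It lies on a supporting line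
that misses the origin (`exists_support`), so no nonzero integer point of the cone lies below it;
applied to the triangle 0, A, A + e this makes A, e a lattice basis (`exists_basis_of_edge`). Since
A - e and A + (k+1)e are outside the cone, the two lines of the continued fraction meet the line A +
se at parameters in (-1, 0] and [k, k+1). Conversely, every such pair of lines has the edge
(`isEdge_of_slopes`).

Measure. In the coordinate s the integral of du dv/(u-v)² over (-1, 0] × [k, k+1) is
log((k+1)²/(k(k+2))). The chart of any other line l differs from s by a fractional linear map, which
preserves this form (`lintegral_lintegral_moebiusPreimage`). The two orderings of the pair
contribute equally, which cancels the factor 1/2. -/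

theorem hasSum_of_eq {f g : ℕ → ℝ} {a : ℝ} (h : HasSum f a) (e : ∀ j, g j = f j) :
    HasSum g a := by
  rwa [funext e]

theorem hasSum_sub_succ {G : ℕ → ℝ} (hG : ∀ n, G (n + 1) ≤ G n) (h0 : Tendsto G atTop (𝓝 0)) :
    HasSum (fun n => G n - G (n + 1)) (G 0) := by
  rw [hasSum_iff_tendsto_nat_of_nonneg fun n => sub_nonneg.2 (hG n)]
  simp only [Finset.sum_range_sub']
  simpa using (tendsto_const_nhds (x := G 0)).sub h0

/-- The inverse branches of the Gauss map. -/
noncomputable def gaussBranch (j : ℕ) (x : ℝ) : ℝ := 1 / (j + 1 + x)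

/-- The transition probabilities of the Gauss–Kuzmin operator. -/
noncomputable def gaussWeight (j : ℕ) (x : ℝ) : ℝ := (1 + x) / ((j + 1 + x) * (j + 2 + x))

/-- The Gauss–Kuzmin operator, acting on densities with respect to `dx / (1 + x)`. -/
noncomputable def gaussOp (g : ℝ → ℝ) (x : ℝ) : ℝ := ∑' j, gaussWeight j x * g (gaussBranch j x)

theorem gaussBranch_mem {x : ℝ} (hx : 0 ≤ x) (j : ℕ) : gaussBranch j x ∈ Icc (0 : ℝ) 1 := by
  have : (0 : ℝ) ≤ j := j.cast_nonneg
  refine ⟨by unfold gaussBranch; positivity, ?_⟩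
  unfold gaussBranch
  rw [div_le_one (by positivity)]
  linarith

theorem gaussWeight_nonneg {x : ℝ} (hx : 0 ≤ x) (j : ℕ) : 0 ≤ gaussWeight j x := by
  unfold gaussWeight; positivity

theorem tendsto_one_div_nat_add (x : ℝ) :
    Tendsto (fun n : ℕ => 1 / ((n : ℝ) + 1 + x)) atTop (𝓝 0) := by
  simp only [one_div]
  apply tendsto_inv_atTop_zero.comp
  exact tendsto_atTop_add_const_right _ _
    (tendsto_atTop_add_const_right _ _ tendsto_natCast_atTop_atTop)

/-- The weight is (1+x)(1/(j+1+x) - 1/(j+2+x)), so the sum telescopes. -/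
theorem hasSum_gaussWeight {x : ℝ} (hx : 0 ≤ x) : HasSum (fun j => gaussWeight j x) 1 := by
  have h := (hasSum_sub_succ (G := fun n : ℕ => 1 / ((n : ℝ) + 1 + x)) (fun n => by
    have : (0 : ℝ) ≤ n := n.cast_nonneg
    push_cast
    exact one_div_le_one_div_of_le (by positivity) (by linarith))
    (tendsto_one_div_nat_add x)).mul_left (1 + x)
  have e : (1 + x) * (1 / (((0 : ℕ) : ℝ) + 1 + x)) = 1 := by
    have : 1 + x ≠ 0 := by positivity
    simp [this]
  rw [e] at h
  refine hasSum_of_eq h fun j => ?_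
  have : (0 : ℝ) ≤ j := j.cast_nonneg
  have h1 : (j : ℝ) + 1 + x ≠ 0 := by positivity
  have h2 : (j : ℝ) + 2 + x ≠ 0 := by positivity
  have h3 : (j : ℝ) + 1 + 1 + x ≠ 0 := by positivity
  unfold gaussWeight
  push_cast
  field_simp
  ring

/-- The reference function of the contraction argument. -/
noncomputable def refFun (u : ℝ) : ℝ := 1 + u - 1 / (1 + u)

/-- With a = j+1+x, the value of `refFun` at 1/a is (2a+1)/(a(a+1)), so the j-th term is (1+x)(1/a²
- 1/(a+1)²) and the series telescopes. -/
theorem gaussOp_refFun {x : ℝ} (hx : 0 ≤ x) : gaussOp refFun x = 1 / (1 + x) := by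
  have h := (hasSum_sub_succ (G := fun n : ℕ => (1 / ((n : ℝ) + 1 + x)) ^ 2) (fun n => by
    have : (0 : ℝ) ≤ n := n.cast_nonneg
    push_cast
    exact pow_le_pow_left₀ (by positivity)
      (one_div_le_one_div_of_le (by positivity) (by linarith)) 2)
    (by simpa using (tendsto_one_div_nat_add x).pow 2)).mul_left (1 + x)
  have h' : HasSum (fun j => gaussWeight j x * refFun (gaussBranch j x))
      ((1 + x) * (1 / (((0 : ℕ) : ℝ) + 1 + x)) ^ 2) := by
    refine hasSum_of_eq h fun j => ?_
    have : (0 : ℝ) ≤ j := j.cast_nonneg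
    have h1 : (j : ℝ) + 1 + x ≠ 0 := by positivity
    have h2 : (j : ℝ) + 2 + x ≠ 0 := by positivity
    have h3 : (j : ℝ) + 1 + 1 + x ≠ 0 := by positivity
    have h4 : (j : ℝ) + 1 + x + 1 ≠ 0 := by positivity
    unfold gaussWeight refFun gaussBranch
    push_cast
    field_simp
    ring
  unfold gaussOp
  rw [h'.tsum_eq]
  have : 1 + x ≠ 0 := by positivity
  simp
  field_simp

theorem summable_gaussOp {g : ℝ → ℝ} {B x : ℝ} (hg : ∀ u ∈ Icc (0 : ℝ) 1, |g u| ≤ B)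
    (hx : 0 ≤ x) : Summable fun j => gaussWeight j x * g (gaussBranch j x) := by
  refine Summable.of_norm_bounded ((hasSum_gaussWeight hx).summable.mul_right B) fun j => ?_
  rw [norm_mul, Real.norm_of_nonneg (gaussWeight_nonneg hx j)]
  exact mul_le_mul_of_nonneg_left (hg _ (gaussBranch_mem hx j)) (gaussWeight_nonneg hx j)

theorem gaussBranch_antitone_left {x : ℝ} (hx : 0 ≤ x) {i j : ℕ} (h : i ≤ j) :
    gaussBranch j x ≤ gaussBranch i x := by
  have : (i : ℝ) ≤ j := by exact_mod_cast h
  have : (0 : ℝ) ≤ i := i.cast_nonneg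
  exact one_div_le_one_div_of_le (by positivity) (by linarith)

theorem gaussBranch_antitone_right {x y : ℝ} (hx : 0 ≤ x) (h : x ≤ y) (j : ℕ) :
    gaussBranch j y ≤ gaussBranch j x := by
  have : (0 : ℝ) ≤ j := j.cast_nonneg
  exact one_div_le_one_div_of_le (by positivity) (by linarith)

theorem gaussWeight_sub {x y : ℝ} (hx : 0 ≤ x) (hy : 0 ≤ y) (j : ℕ) :
    gaussWeight j x - gaussWeight j y = (y - x) * ((1 + x) * (1 + y) - j * (j + 1)) /
      ((j + 1 + x) * (j + 2 + x) * ((j + 1 + y) * (j + 2 + y))) := by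
  have : (0 : ℝ) ≤ j := j.cast_nonneg
  unfold gaussWeight
  rw [div_sub_div _ _ (by positivity) (by positivity)]
  congr 1
  ring

/-- The Gauss–Kuzmin operator reverses monotonicity. -/
theorem antitoneOn_gaussOp {g : ℝ → ℝ} {B : ℝ} (hg : ∀ u ∈ Icc (0 : ℝ) 1, |g u| ≤ B)
    (hm : MonotoneOn g (Icc 0 1)) : AntitoneOn (gaussOp g) (Icc 0 1) := by
  rintro x ⟨hx, hx1⟩ y ⟨hy, hy1⟩ hxy
  set c : ℕ → ℝ := fun j => g (gaussBranch j y)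
  have s1 : Summable fun j => gaussWeight j x * c j := by
    refine Summable.of_norm_bounded ((hasSum_gaussWeight hx).summable.mul_right B) fun j => ?_
    rw [norm_mul, Real.norm_of_nonneg (gaussWeight_nonneg hx j)]
    exact mul_le_mul_of_nonneg_left (hg _ (gaussBranch_mem hy j)) (gaussWeight_nonneg hx j)
  have s2 := summable_gaussOp hg hy
  have h1 : ∑' j, gaussWeight j x * c j ≤ gaussOp g x :=
    s1.tsum_le_tsum (fun j => mul_le_mul_of_nonneg_left
      (hm (gaussBranch_mem hy j) (gaussBranch_mem hx j) (gaussBranch_antitone_right hx hxy j))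
      (gaussWeight_nonneg hx j)) (summable_gaussOp hg hx)
  -- Both families of weights have sum 1, so the constant `c 1` may be subtracted from `c` for free.
  -- This kills the term j = 1, the only one where the sign of the weight difference is
  -- undetermined.
  have h2 : HasSum (fun j => (gaussWeight j x - gaussWeight j y) * (c j - c 1))
      (∑' j, gaussWeight j x * c j - gaussOp g y) := by
    have h := (s1.hasSum.sub s2.hasSum).sub
      (((hasSum_gaussWeight hx).sub (hasSum_gaussWeight hy)).mul_right (c 1))
    rw [sub_self, zero_mul, sub_zero] at h
    refine hasSum_of_eq h fun j => ?_
    simp only [c]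
    ring
  -- The sign of the weight difference is that of (1+x)(1+y) - j(j+1). The product lies in [1, 4],
  -- while j(j+1) is 0 for j = 0 and at least 6 for j ≥ 2. As `c` decreases in j, each remaining
  -- term is a product of two factors of equal sign.
  have hP : 1 ≤ (1 + x) * (1 + y) := by nlinarith [mul_nonneg hx hy]
  have hP4 : (1 + x) * (1 + y) ≤ 4 := by nlinarith
  have h3 : 0 ≤ ∑' j, gaussWeight j x * c j - gaussOp g y := by
    refine h2.nonneg fun j => ?_
    rw [gaussWeight_sub hx hy]
    have hc : ∀ i k : ℕ, i ≤ k → c k ≤ c i := fun i k hik =>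
      hm (gaussBranch_mem hy k) (gaussBranch_mem hy i) (gaussBranch_antitone_left hy hik)
    rcases lt_trichotomy j 1 with hj | rfl | hj
    · obtain rfl : j = 0 := by omega
      refine mul_nonneg (div_nonneg (mul_nonneg (by linarith) ?_) (by positivity))
        (sub_nonneg.2 (hc 0 1 zero_le_one))
      push_cast
      linarith
    · simp
    · have hj' : (2 : ℝ) ≤ j := by exact_mod_cast hj
      refine mul_nonneg_of_nonpos_of_nonpos (div_nonpos_of_nonpos_of_nonneg
        (mul_nonpos_of_nonneg_of_nonpos (by linarith) ?_) (by positivity))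
        (sub_nonpos.2 (hc 1 j hj.le))
      nlinarith
  linarith

theorem gaussOp_mem {g : ℝ → ℝ} (hg : ∀ u ∈ Icc (0 : ℝ) 1, g u ∈ Icc (0 : ℝ) 2) {x : ℝ}
    (hx : 0 ≤ x) : gaussOp g x ∈ Icc (0 : ℝ) 2 := by
  constructor
  · exact tsum_nonneg fun j =>
      mul_nonneg (gaussWeight_nonneg hx j) (hg _ (gaussBranch_mem hx j)).1
  · have hs := summable_gaussOp (B := 2) (fun u hu => abs_le.2 ⟨by linarith [(hg u hu).1],
      (hg u hu).2⟩) hx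
    have h2 := (hasSum_gaussWeight hx).mul_right 2
    have := hs.tsum_le_tsum (fun j => mul_le_mul_of_nonneg_left (hg _ (gaussBranch_mem hx j)).2
      (gaussWeight_nonneg hx j)) h2.summable
    rw [h2.tsum_eq] at this
    simpa [gaussOp] using this

/-- The density of the `n`-th remainder with respect to `dx / (1 + x)`. -/
noncomputable def gaussDensity (n : ℕ) : ℝ → ℝ := gaussOp^[n] fun x => 1 + x

theorem gaussDensity_succ (n : ℕ) : gaussDensity (n + 1) = gaussOp (gaussDensity n) :=
  Function.iterate_succ_apply' _ _ _

theorem gaussDensity_mem (n : ℕ) {x : ℝ} (hx : x ∈ Icc (0 : ℝ) 1) :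
    gaussDensity n x ∈ Icc (0 : ℝ) 2 := by
  induction n generalizing x with
  | zero =>
    show 1 + x ∈ _
    exact ⟨by linarith [hx.1], by linarith [hx.2]⟩
  | succ n ih =>
    rw [gaussDensity_succ]
    exact gaussOp_mem (fun u hu => ih hu) hx.1

theorem measurable_gaussOp {g : ℝ → ℝ} (hg : Measurable g) : Measurable (gaussOp g) := by
  unfold gaussOp
  refine Measurable.tsum fun j => ?_
  unfold gaussWeight gaussBranch
  fun_prop

theorem measurable_gaussDensity (n : ℕ) : Measurable (gaussDensity n) := by
  induction n with
  | zero => exact measurable_const.add measurable_id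
  | succ n ih => rw [gaussDensity_succ]; exact measurable_gaussOp ih

/-! ### Contraction of the Gauss–Kuzmin operator -/

theorem abs_refFun_le {u : ℝ} (hu : u ∈ Icc (0 : ℝ) 1) : |refFun u| ≤ 2 := by
  have h1 : 0 < 1 / (1 + u) := by have := hu.1; positivity
  have h2 : 1 / (1 + u) ≤ 1 := by
    rw [div_le_one (by linarith [hu.1])]; linarith [hu.1]
  unfold refFun
  exact abs_le.2 ⟨by linarith [hu.1], by linarith [hu.2]⟩

/-- With t = 1+u the function is (t + 1/t)/2, which increases for t ≥ 1. This is the source of the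
contraction factor 1/2. -/
theorem monotoneOn_refFun_half_add :
    MonotoneOn (fun u : ℝ => refFun u / 2 + 1 / (1 + u)) (Icc 0 1) := by
  rintro x ⟨hx, -⟩ y ⟨hy, -⟩ hxy
  have : refFun y / 2 + 1 / (1 + y) - (refFun x / 2 + 1 / (1 + x))
      = (y - x) * (x + y + x * y) / (2 * ((1 + x) * (1 + y))) := by
    unfold refFun
    have h1 : 1 + x ≠ 0 := by positivity
    have h2 : 1 + y ≠ 0 := by positivity
    field_simp
    ring
  have h3 : 0 ≤ (y - x) * (x + y + x * y) / (2 * ((1 + x) * (1 + y))) :=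
    div_nonneg (mul_nonneg (by linarith) (by positivity)) (by positivity)
  simp only
  linarith

/-- By linearity the operator sends the given increasing function to the decreasing function r/(1+x)
+ ε `gaussOp g`. Subtracting this from the increasing function r(`refFun`/2 + 1/(1+x)) leaves the
claim. -/
theorem monotoneOn_of_gaussOp {g : ℝ → ℝ} {B r ε : ℝ} (hr : 0 ≤ r) (hε : ε ^ 2 = 1)
    (hg : ∀ u ∈ Icc (0 : ℝ) 1, |g u| ≤ B)
    (hm : MonotoneOn (fun u => r * refFun u + ε * g u) (Icc 0 1)) :
    MonotoneOn (fun u => r / 2 * refFun u - ε * gaussOp g u) (Icc 0 1) := by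
  have hb : ∀ u ∈ Icc (0 : ℝ) 1, |r * refFun u + ε * g u| ≤ r * 2 + B := by
    intro u hu
    have hε' : |ε| = 1 := by
      rw [← sq_abs] at hε
      nlinarith [abs_nonneg ε]
    refine (abs_add_le _ _).trans (add_le_add ?_ ?_)
    · rw [abs_mul, abs_of_nonneg hr]
      exact mul_le_mul_of_nonneg_left (abs_refFun_le hu) hr
    · rw [abs_mul, hε', one_mul]
      exact hg u hu
  have ha := antitoneOn_gaussOp hb hm
  have heq : ∀ x ∈ Icc (0 : ℝ) 1, gaussOp (fun u => r * refFun u + ε * g u) x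
      = r * (1 / (1 + x)) + ε * gaussOp g x := by
    intro x hx
    rw [← gaussOp_refFun hx.1]
    unfold gaussOp
    rw [← tsum_mul_left, ← tsum_mul_left, ← Summable.tsum_add]
    · congr 1; ext j; ring
    · exact (summable_gaussOp (fun u hu => abs_refFun_le hu) hx.1).mul_left r
    · exact (summable_gaussOp hg hx.1).mul_left ε
  intro x hx y hy hxy
  have h1 := ha hx hy hxy
  rw [heq x hx, heq y hy] at h1
  have h2 := mul_le_mul_of_nonneg_left (monotoneOn_refFun_half_add hx hy hxy) hr
  simp only at h2 ⊢
  nlinarith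

/-- For ε = 1 and ε = -1 together, this bounds the increments of the n-th density by 2⁻ⁿ times those
of `refFun`. Each step flips the sign, so the induction carries both. At n = 0 the case ε = -1 is
the function -1/(1+u). -/
theorem monotoneOn_gaussDensity (n : ℕ) {ε : ℝ} (hε : ε ^ 2 = 1) :
    MonotoneOn (fun u => (1 / 2) ^ n * refFun u + ε * gaussDensity n u) (Icc 0 1) := by
  induction n generalizing ε with
  | zero =>
    rintro x ⟨hx, -⟩ y ⟨hy, -⟩ hxy
    have h1 : 1 / (1 + y) ≤ 1 / (1 + x) := one_div_le_one_div_of_le (by positivity) (by linarith)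
    have h2 : -1 ≤ ε := by nlinarith
    simp only [gaussDensity, refFun, Function.iterate_zero, id]
    nlinarith [mul_le_mul_of_nonneg_right h2 (sub_nonneg.2 hxy)]
  | succ n ih =>
    have h := monotoneOn_of_gaussOp (B := 2) (ε := -ε) (by positivity) (by simpa using hε)
      (fun u hu => abs_le.2 ⟨by linarith [(gaussDensity_mem n hu).1], (gaussDensity_mem n hu).2⟩)
      (ih (ε := -ε) (by simpa using hε))
    rw [gaussDensity_succ]
    convert h using 2
    ring

/-- The densities become constant exponentially fast. -/
theorem abs_gaussDensity_sub_le (n : ℕ) {x : ℝ} (hx : x ∈ Icc (0 : ℝ) 1) :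
    |gaussDensity n x - gaussDensity n 0| ≤ 2 * (1 / 2) ^ n := by
  have h0 : (0 : ℝ) ∈ Icc (0 : ℝ) 1 := ⟨le_rfl, zero_le_one⟩
  have h1 := monotoneOn_gaussDensity n (ε := 1) (by norm_num) h0 hx hx.1
  have h2 := monotoneOn_gaussDensity n (ε := -1) (by norm_num) h0 hx hx.1
  have h3 := (abs_le.1 (abs_refFun_le hx)).2
  have h4 : refFun 0 = 0 := by simp [refFun]
  have h5 : (0 : ℝ) < (1 / 2) ^ n := by positivity
  simp only [h4] at h1 h2
  have := mul_le_mul_of_nonneg_left h3 h5.le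
  exact abs_le.2 ⟨by linarith, by linarith⟩

/-! ### The Gauss map and the digits -/

theorem image_gaussBranch (j : ℕ) :
    gaussBranch j '' Ico 0 1 = Ioc (1 / ((j : ℝ) + 2)) (1 / ((j : ℝ) + 1)) := by
  have hj : (0 : ℝ) ≤ j := j.cast_nonneg
  ext u
  simp only [gaussBranch, mem_image, mem_Ico, mem_Ioc]
  constructor
  · rintro ⟨x, ⟨hx, hx1⟩, rfl⟩
    exact ⟨one_div_lt_one_div_of_lt (by positivity) (by linarith),
      one_div_le_one_div_of_le (by positivity) (by linarith)⟩
  · rintro ⟨h1, h2⟩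
    have hu : 0 < u := lt_trans (by positivity) h1
    rw [div_lt_iff₀ (by positivity)] at h1
    rw [le_div_iff₀ (by positivity)] at h2
    refine ⟨1 / u - (j + 1), ⟨?_, ?_⟩, ?_⟩
    · rw [sub_nonneg, le_div_iff₀ hu]; linarith
    · rw [sub_lt_iff_lt_add, div_lt_iff₀ hu]; linarith
    · rw [add_sub_cancel, one_div_one_div]

theorem iUnion_image_gaussBranch : ⋃ j, gaussBranch j '' Ico 0 1 = Ioc (0 : ℝ) 1 := by
  ext u
  simp only [mem_iUnion]
  constructor
  · rintro ⟨j, x, hx, rfl⟩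
    have : (0 : ℝ) ≤ j := j.cast_nonneg
    refine ⟨?_, (gaussBranch_mem hx.1 j).2⟩
    have := hx.1
    unfold gaussBranch
    positivity
  · rintro ⟨h0, h1⟩
    have h2 : 1 ≤ 1 / u := by rwa [le_div_iff₀ h0, one_mul]
    have h3 : 1 ≤ ⌊1 / u⌋₊ := Nat.le_floor (by exact_mod_cast h2)
    refine ⟨⌊1 / u⌋₊ - 1, 1 / u - ⌊1 / u⌋₊, ⟨?_, ?_⟩, ?_⟩
    · exact sub_nonneg.2 (Nat.floor_le (by positivity))
    · linarith [Nat.lt_floor_add_one (1 / u)]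
    · unfold gaussBranch
      rw [Nat.cast_sub h3]
      simp

theorem pairwise_disjoint_image_gaussBranch :
    Pairwise (Function.onFun Disjoint fun j => gaussBranch j '' Ico 0 1) := by
  refine (pairwise_disjoint_on _).2 fun i j hij => ?_
  rw [image_gaussBranch, image_gaussBranch]
  refine Set.disjoint_left.2 fun u hi hj => ?_
  have : (i : ℝ) + 1 ≤ j := by exact_mod_cast hij
  have h0 : (0 : ℝ) ≤ i := i.cast_nonneg
  have : 1 / ((j : ℝ) + 1) ≤ 1 / ((i : ℝ) + 2) :=
    one_div_le_one_div_of_le (by positivity) (by linarith)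
  linarith [hi.1, hj.2]

theorem lintegral_image_gaussBranch (j : ℕ) (F : ℝ → ENNReal) :
    ∫⁻ u in gaussBranch j '' Ico 0 1, F u
      = ∫⁻ x in Ico (0 : ℝ) 1, ENNReal.ofReal (1 / (j + 1 + x) ^ 2) * F (gaussBranch j x) := by
  have hj : (0 : ℝ) ≤ j := j.cast_nonneg
  have h := lintegral_image_eq_lintegral_abs_deriv_mul (s := Ico (0 : ℝ) 1) measurableSet_Ico
    (f := gaussBranch j) (f' := fun x => -1 / (j + 1 + x) ^ 2) (fun x hx => by
      have hx0 := hx.1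
      have h1 : HasDerivAt (fun x : ℝ => (j : ℝ) + 1 + x) 1 x := (hasDerivAt_id x).const_add _
      have h2 := h1.inv (by positivity)
      refine HasDerivAt.hasDerivWithinAt ?_
      have h3 : gaussBranch j = (fun x : ℝ => (j : ℝ) + 1 + x)⁻¹ := by
        ext x
        simp [gaussBranch]
      rwa [h3]) (fun x hx y hy hxy => by
      have hx0 := hx.1
      have hy0 := hy.1
      simp only [gaussBranch] at hxy
      have := (div_eq_div_iff (by positivity) (by positivity)).1 hxy
      linarith) F
  rw [h]
  refine setLIntegral_congr_fun measurableSet_Ico fun x hx => ?_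
  rw [abs_div, abs_neg, abs_one, abs_of_nonneg (by positivity)]

/-- The transfer of an integral along the Gauss map. -/
theorem lintegral_gauss_transfer {D D' : Set ℝ} (hD : MeasurableSet D)
    (hDD : ∀ j : ℕ, ∀ x ∈ Ico (0 : ℝ) 1, (gaussBranch j x ∈ D' ↔ x ∈ D)) {g : ℝ → ℝ} {B : ℝ}
    (hg : Measurable g) (h0 : ∀ u ∈ Icc (0 : ℝ) 1, 0 ≤ g u)
    (hB : ∀ u ∈ Icc (0 : ℝ) 1, |g u| ≤ B) :
    ∫⁻ u in Ioc (0 : ℝ) 1, D'.indicator (fun u => ENNReal.ofReal (g u / (1 + u))) u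
      = ∫⁻ x in Ioc (0 : ℝ) 1, D.indicator (fun x => ENNReal.ofReal (gaussOp g x / (1 + x))) x := by
  rw [← iUnion_image_gaussBranch, lintegral_iUnion
    (fun j => by rw [image_gaussBranch]; exact measurableSet_Ioc)
    pairwise_disjoint_image_gaussBranch]
  simp only [lintegral_image_gaussBranch]
  rw [iUnion_image_gaussBranch, ← Measure.restrict_congr_set (Ico_ae_eq_Ioc (a := (0 : ℝ)) (b := 1))]
  -- Under u = 1/(j+1+x) the measure du/(1+u) becomes dx/((j+1+x)(j+2+x)), which is the j-th weight
  -- times dx/(1+x).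
  have : ∀ j : ℕ, ∫⁻ x in Ico (0 : ℝ) 1, ENNReal.ofReal (1 / (j + 1 + x) ^ 2) *
        D'.indicator (fun u => ENNReal.ofReal (g u / (1 + u))) (gaussBranch j x)
      = ∫⁻ x in Ico (0 : ℝ) 1, D.indicator
        (fun x => ENNReal.ofReal (gaussWeight j x * g (gaussBranch j x) / (1 + x))) x := by
    intro j
    have hj : (0 : ℝ) ≤ j := j.cast_nonneg
    refine setLIntegral_congr_fun measurableSet_Ico fun x hx => ?_
    by_cases hxD : x ∈ D
    · rw [indicator_of_mem hxD, indicator_of_mem ((hDD j x hx).2 hxD),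
        ← ENNReal.ofReal_mul (by positivity)]
      congr 1
      have hx0 := hx.1
      unfold gaussWeight
      generalize hG : g (gaussBranch j x) = G
      unfold gaussBranch
      have h1 : (j : ℝ) + 1 + x ≠ 0 := by positivity
      have h2 : (j : ℝ) + 2 + x ≠ 0 := by positivity
      have h3 : (j : ℝ) + 1 + x + 1 ≠ 0 := by positivity
      have h4 : 1 + x ≠ 0 := by positivity
      field_simp
      ring
    · rw [indicator_of_notMem hxD, indicator_of_notMem (fun h => hxD ((hDD j x hx).1 h)), mul_zero]
  simp only [this]
  rw [← lintegral_tsum]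
  · refine setLIntegral_congr_fun measurableSet_Ico fun x hx => ?_
    by_cases hxD : x ∈ D
    · simp only [indicator_of_mem hxD]
      have hx0 := hx.1
      rw [← ENNReal.ofReal_tsum_of_nonneg]
      · rw [tsum_div_const]
        rfl
      · exact fun j => div_nonneg (mul_nonneg (gaussWeight_nonneg hx0 j)
          (h0 _ (gaussBranch_mem hx0 j))) (by positivity)
      · exact (summable_gaussOp hB hx0).div_const _
    · simp [indicator_of_notMem hxD]
  · intro j
    refine Measurable.aemeasurable (Measurable.indicator ?_ hD)
    unfold gaussWeight gaussBranch
    fun_prop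

/-- The set of the numbers with `n`-th digit `k`. -/
def digitSet (n k : ℕ) : Set ℝ := {α | (GenContFract.of α).partDens.get? n = some (k : ℝ)}

theorem digitSet_succ (n k : ℕ) :
    digitSet (n + 1) k = (fun α => (Int.fract α)⁻¹) ⁻¹' digitSet n k := by
  ext α
  simp only [digitSet, mem_ofPred_eq, mem_preimage, GenContFract.partDens, Stream'.Seq.map_get?,
    GenContFract.of_s_succ]

theorem mem_digitSet_zero {k : ℕ} {α : ℝ} :
    α ∈ digitSet 0 k ↔ Int.fract α ≠ 0 ∧ ⌊(Int.fract α)⁻¹⌋ = k := by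
  simp only [digitSet, mem_ofPred_eq, GenContFract.partDens, Stream'.Seq.map_get?]
  by_cases h : Int.fract α = 0
  · obtain ⟨a, rfl⟩ : ∃ a : ℤ, α = a := ⟨⌊α⌋, eq_of_sub_eq_zero h⟩
    simp [GenContFract.of_s_of_int]
  · have := GenContFract.of_s_head h
    rw [Stream'.Seq.head] at this
    rw [this]
    simp only [Option.map_some, Option.some.injEq, ne_eq, h, not_false_eq_true, true_and]
    exact_mod_cast Iff.rfl

theorem measurableSet_digitSet (n k : ℕ) : MeasurableSet (digitSet n k) := by
  induction n with
  | zero =>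
    have : digitSet 0 k = {α | Int.fract α ≠ 0} ∩ {α | ⌊(Int.fract α)⁻¹⌋ = (k : ℤ)} := by
      ext α; exact mem_digitSet_zero
    rw [this]
    exact (measurable_fract (measurableSet_singleton (0 : ℝ)).compl).inter
      ((Int.measurable_floor.comp measurable_fract.inv) (measurableSet_singleton (k : ℤ)))
  | succ n ih =>
    rw [digitSet_succ]
    exact measurable_fract.inv ih

theorem mem_digitSet_congr {x y : ℝ} (h : Int.fract x = Int.fract y) (n k : ℕ) :
    x ∈ digitSet n k ↔ y ∈ digitSet n k := by
  cases n with
  | zero => rw [mem_digitSet_zero, mem_digitSet_zero, h]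
  | succ n => simp only [digitSet_succ, mem_preimage, h]

theorem gaussBranch_mem_digitSet_succ (n k j : ℕ) {x : ℝ} (hx : x ∈ Ico (0 : ℝ) 1) :
    gaussBranch j x ∈ digitSet (n + 1) k ↔ x ∈ digitSet n k := by
  have hj : (0 : ℝ) ≤ j := j.cast_nonneg
  have hx0 := hx.1
  rw [digitSet_succ, mem_preimage]
  -- The value 1 occurs only for j = 0 and x = 0. Its fractional part is 0, and the convention 0⁻¹ =
  -- 0 returns x.
  rcases (gaussBranch_mem hx0 j).2.eq_or_lt with h | h
  · have hx' : x = 0 := by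
      unfold gaussBranch at h
      rw [div_eq_one_iff_eq (by positivity)] at h
      linarith
    rw [h, hx', Int.fract_one, inv_zero]
  · rw [Int.fract_eq_self.2 ⟨(gaussBranch_mem hx0 j).1, h⟩]
    apply mem_digitSet_congr
    unfold gaussBranch
    rw [one_div, inv_inv, show (j : ℝ) + 1 + x = x + ((j + 1 : ℕ) : ℝ) by push_cast; ring,
      Int.fract_add_natCast]

theorem lintegral_gaussDensity (n : ℕ) {D : ℕ → Set ℝ} (hD : ∀ n, MeasurableSet (D n))
    (hDD : ∀ n j : ℕ, ∀ x ∈ Ico (0 : ℝ) 1, (gaussBranch j x ∈ D (n + 1) ↔ x ∈ D n)) :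
    volume (Ioc 0 1 ∩ D n)
      = ∫⁻ u in Ioc (0 : ℝ) 1 ∩ D 0, ENNReal.ofReal (gaussDensity n u / (1 + u)) := by
  -- Each application of the transfer lowers the index of `D` by one and raises that of the density
  -- by one. The start n = 0 is Lebesgue measure, as the initial density 1+u cancels the
  -- denominator.
  have key : ∀ m, ∀ n,
      ∫⁻ u in Ioc (0 : ℝ) 1, (D m).indicator
        (fun u => ENNReal.ofReal (gaussDensity n u / (1 + u))) u
      = ∫⁻ u in Ioc (0 : ℝ) 1, (D 0).indicator
        (fun u => ENNReal.ofReal (gaussDensity (n + m) u / (1 + u))) u := by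
    intro m
    induction m with
    | zero => intro n; rfl
    | succ m ih =>
      intro n
      rw [lintegral_gauss_transfer (hD m) (hDD m) (measurable_gaussDensity n)
        (fun u hu => (gaussDensity_mem n hu).1) (B := 2)
        (fun u hu => abs_le.2 ⟨by linarith [(gaussDensity_mem n hu).1], (gaussDensity_mem n hu).2⟩)]
      rw [← gaussDensity_succ, ih, Nat.add_right_comm, Nat.add_assoc]
  have h := key n 0
  rw [zero_add, lintegral_indicator (hD 0), lintegral_indicator (hD n),
    Measure.restrict_restrict (hD 0), Measure.restrict_restrict (hD n),
    inter_comm (D 0), inter_comm (D n)] at h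
  rw [← h, ← setLIntegral_one]
  refine setLIntegral_congr_fun (measurableSet_Ioc.inter (hD n)) fun u hu => ?_
  have : 1 + u ≠ 0 := by linarith [hu.1.1]
  simp [gaussDensity, this]

theorem volume_real_gaussDensity (n : ℕ) {a b : ℝ} (ha : 0 ≤ a) (hb : b ≤ 1) :
    (∫⁻ u in Ioc a b, ENNReal.ofReal (gaussDensity n u / (1 + u))).toReal
      = ∫ u in Ioc a b, gaussDensity n u / (1 + u) := by
  rw [integral_eq_lintegral_of_nonneg_ae]
  · filter_upwards [ae_restrict_mem measurableSet_Ioc] with u hu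
    have hu0 : 0 < u := ha.trans_lt hu.1
    exact div_nonneg (gaussDensity_mem n ⟨hu0.le, hu.2.trans hb⟩).1 (by positivity)
  · exact ((measurable_gaussDensity n).div
      (measurable_const.add measurable_id)).aestronglyMeasurable

/-- Replacing the density by its value at 0 changes the integrand by at most 2·2⁻ⁿ, and the constant
integrates against du/(1+u) to a logarithm. -/
theorem abs_integral_gaussDensity_sub_le (n : ℕ) {a b : ℝ} (ha : 0 ≤ a) (hab : a ≤ b)
    (hb : b ≤ 1) :
    |(∫ u in Ioc a b, gaussDensity n u / (1 + u))
      - gaussDensity n 0 * Real.log ((1 + b) / (1 + a))| ≤ 2 * (1 / 2) ^ n := by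
  have hlog : ∫ u in Ioc a b, 1 / (1 + u) = Real.log ((1 + b) / (1 + a)) := by
    rw [← intervalIntegral.integral_of_le hab,
      intervalIntegral.integral_comp_add_left (fun u => 1 / u) 1,
      integral_one_div_of_pos (by linarith) (by linarith)]
  have hint : IntegrableOn (fun u : ℝ => 1 / (1 + u)) (Ioc a b) := by
    rw [← intervalIntegrable_iff_integrableOn_Ioc_of_le hab]
    apply ContinuousOn.intervalIntegrable_of_Icc hab
    refine continuousOn_const.div (by fun_prop) fun u hu => ?_
    linarith [hu.1]
  have hbd : ∀ u ∈ Ioc a b, ‖(gaussDensity n u - gaussDensity n 0) / (1 + u)‖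
      ≤ 2 * (1 / 2) ^ n := by
    intro u hu
    have hu0 : 0 < u := ha.trans_lt hu.1
    rw [norm_div, Real.norm_of_nonneg (by positivity : 0 ≤ 1 + u), div_le_iff₀ (by positivity)]
    refine (abs_gaussDensity_sub_le n ⟨hu0.le, hu.2.trans hb⟩).trans ?_
    have : (0 : ℝ) ≤ 2 * (1 / 2) ^ n := by positivity
    nlinarith
  have hint2 : IntegrableOn (fun u : ℝ => (gaussDensity n u - gaussDensity n 0) / (1 + u))
      (Ioc a b) := by
    refine Measure.integrableOn_of_bounded (M := 2 * (1 / 2) ^ n) (by simp) ?_ ?_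
    · exact (((measurable_gaussDensity n).sub measurable_const).div
        (measurable_const.add measurable_id)).aestronglyMeasurable
    · filter_upwards [ae_restrict_mem measurableSet_Ioc] with u hu using hbd u hu
  have hsplit : ∫ u in Ioc a b, gaussDensity n u / (1 + u)
      = (∫ u in Ioc a b, (gaussDensity n u - gaussDensity n 0) / (1 + u))
        + gaussDensity n 0 * Real.log ((1 + b) / (1 + a)) := by
    rw [← hlog, ← integral_const_mul, ← integral_add hint2 (hint.const_mul _)]
    congr 1
    ext u
    ring
  rw [hsplit, add_sub_cancel_right, ← Real.norm_eq_abs]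
  refine (norm_setIntegral_le_of_norm_le_const (by simp) hbd).trans ?_
  have h1 : volume.real (Ioc a b) ≤ 1 := by
    rw [Real.volume_real_Ioc_of_le hab]
    linarith
  have : (0 : ℝ) ≤ 2 * (1 / 2) ^ n := by positivity
  nlinarith

/-- The densities tend to that of the Gauss measure. -/
theorem tendsto_gaussDensity_zero :
    Tendsto (fun n => gaussDensity n 0) atTop (𝓝 (1 / Real.log 2)) := by
  have hlog : 0 < Real.log 2 := Real.log_pos one_lt_two
  -- The total mass stays 1, as the transfer with `D` constantly `univ` shows. Over the whole
  -- interval the logarithm is log 2, which pins down the limit.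
  have htot : ∀ n, ∫ u in Ioc (0 : ℝ) 1, gaussDensity n u / (1 + u) = 1 := by
    intro n
    rw [← volume_real_gaussDensity n le_rfl le_rfl]
    have := lintegral_gaussDensity n (D := fun _ => univ) (fun _ => MeasurableSet.univ)
      (fun _ _ _ _ => Iff.rfl)
    simp only [inter_univ] at this
    rw [← this]
    simp
  have hε : Tendsto (fun n : ℕ => 2 * (1 / 2 : ℝ) ^ n) atTop (𝓝 0) := by
    simpa using (tendsto_pow_atTop_nhds_zero_of_lt_one (r := (1 / 2 : ℝ)) (by norm_num)
      (by norm_num)).const_mul 2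
  have h1 : Tendsto (fun n => 1 - gaussDensity n 0 * Real.log 2) atTop (𝓝 0) := by
    refine squeeze_zero_norm (fun n => ?_) hε
    have := abs_integral_gaussDensity_sub_le n (le_refl (0 : ℝ)) zero_le_one le_rfl
    rw [htot] at this
    norm_num at this ⊢
    exact this
  have h2 := ((tendsto_const_nhds (x := (1 : ℝ))).sub h1).div_const (Real.log 2)
  simp only [sub_sub_cancel, sub_zero] at h2
  refine h2.congr fun n => ?_
  field_simp

/-- The Gauss–Kuzmin theorem for a single digit. -/
theorem isDigitFrequency_log {k : ℕ} (hk : 0 < k) :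
    IsDigitFrequency k
      (Real.log (((k : ℝ) + 1) ^ 2 / (k * (k + 2))) / Real.log 2) := by
  have hk' : (1 : ℝ) ≤ k := by exact_mod_cast hk
  have hk0 : (0 : ℝ) < k := by linarith
  -- The exception u = 1 matters for k = 1: it lies in the interval on the right, but its fractional
  -- part is 0, so it has no digit.
  have hset : (Ioc (0 : ℝ) 1 ∩ digitSet 0 k : Set ℝ)
      =ᵐ[volume] Ioc (1 / ((k : ℝ) + 1)) (1 / k) := by
    have h1 : ∀ᵐ u : ℝ, u ≠ 1 := by
      simp [ae_iff, measure_singleton]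
    filter_upwards [h1] with u hu
    apply propext
    change (u ∈ Ioc (0 : ℝ) 1 ∧ u ∈ digitSet 0 k) ↔ u ∈ Ioc _ _
    rw [mem_digitSet_zero, mem_Ioc, mem_Ioc]
    have aux : 0 < u → u < 1 → (⌊u⁻¹⌋ = (k : ℤ) ↔ 1 / ((k : ℝ) + 1) < u ∧ u ≤ 1 / k) := by
      intro h0 h1
      rw [Int.floor_eq_iff, div_lt_iff₀ (by positivity), le_div_iff₀ hk0, ← one_div,
        le_div_iff₀ h0, div_lt_iff₀ h0, mul_comm u, mul_comm u]
      push_cast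
      exact and_comm
    constructor
    · rintro ⟨⟨h0, h1⟩, h2, h3⟩
      have h1' := lt_of_le_of_ne h1 hu
      rw [Int.fract_eq_self.2 ⟨h0.le, h1'⟩] at h3
      exact (aux h0 h1').1 h3
    · rintro ⟨h2, h3⟩
      have h0 : 0 < u := lt_trans (by positivity) h2
      have h1 : u ≤ 1 := h3.trans (by rw [div_le_one hk0]; exact hk')
      have h1' := lt_of_le_of_ne h1 hu
      rw [Int.fract_eq_self.2 ⟨h0.le, h1'⟩]
      exact ⟨⟨h0, h1⟩, h0.ne', (aux h0 h1').2 ⟨h2, h3⟩⟩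
  have hprob : ∀ n, digitProbability n k
      = ∫ u in Ioc (1 / ((k : ℝ) + 1)) (1 / k), gaussDensity n u / (1 + u) := by
    intro n
    rw [← volume_real_gaussDensity n (by positivity) (by rw [div_le_one hk0]; exact hk'),
      ← Measure.restrict_congr_set hset, ← lintegral_gaussDensity n (D := fun n => digitSet n k)
      (fun n => measurableSet_digitSet n k)
      (fun n j x hx => gaussBranch_mem_digitSet_succ n k j hx)]
    unfold digitProbability
    rw [Measure.real]
    congr 1
    refine measure_congr ?_
    exact (Ioc_ae_eq_Icc (a := (0 : ℝ)) (b := 1)).symm.inter (ae_eq_refl (digitSet n k))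
  have hlog : Real.log ((1 + 1 / (k : ℝ)) / (1 + 1 / ((k : ℝ) + 1)))
      = Real.log (((k : ℝ) + 1) ^ 2 / (k * (k + 2))) := by
    congr 1
    field_simp
    ring
  have hle : 1 / ((k : ℝ) + 1) ≤ 1 / k := one_div_le_one_div_of_le hk0 (by linarith)
  have hε : Tendsto (fun n : ℕ => 2 * (1 / 2 : ℝ) ^ n) atTop (𝓝 0) := by
    simpa using (tendsto_pow_atTop_nhds_zero_of_lt_one (r := (1 / 2 : ℝ)) (by norm_num)
      (by norm_num)).const_mul 2
  have h1 : Tendsto (fun n => digitProbability n k - gaussDensity n 0 *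
      Real.log (((k : ℝ) + 1) ^ 2 / (k * (k + 2)))) atTop (𝓝 0) := by
    refine squeeze_zero_norm (fun n => ?_) hε
    rw [hprob, ← hlog]
    exact abs_integral_gaussDensity_sub_le n (by positivity) hle
      (by rw [div_le_one hk0]; exact hk')
  have h2 := h1.add (tendsto_gaussDensity_zero.mul_const
    (Real.log (((k : ℝ) + 1) ^ 2 / (k * (k + 2)))))
  simp only [sub_add_cancel, zero_add, one_div_mul_eq_div] at h2
  exact h2

/-! ### Geometry of the plane -/

theorem Plane.ext {z w : Plane} (h0 : z 0 = w 0) (h1 : z 1 = w 1) : z = w := by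
  ext i
  fin_cases i
  · exact h0
  · exact h1

/-- The determinant of a pair of vectors of the plane. -/
def planeDet (z w : Plane) : ℝ := z 0 * w 1 - z 1 * w 0

theorem cramer (v w z : Plane) :
    planeDet v w • z = planeDet z w • v + planeDet v z • w := by
  apply Plane.ext <;> simp [planeDet] <;> ring

theorem exists_smul_of_planeDet_eq_zero {u z : Plane} (hu : u ≠ 0) (h : planeDet u z = 0) :
    ∃ r : ℝ, z = r • u := by
  unfold planeDet at h
  by_cases h0 : u 0 = 0
  · have h1 : u 1 ≠ 0 := fun h1 => hu (Plane.ext (by simpa using h0) (by simpa using h1))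
    refine ⟨z 1 / u 1, Plane.ext ?_ ?_⟩
    · have : u 1 * z 0 = 0 := by rw [h0] at h; linarith
      simp [h0, (mul_eq_zero.1 this).resolve_left h1]
    · simp [h1]
  · refine ⟨z 0 / u 0, Plane.ext ?_ ?_⟩
    · simp [h0]
    · simp only [PiLp.smul_apply, smul_eq_mul]
      field_simp
      linarith

theorem abs_planeDet_le {d w : Plane} (hd : ∀ i, |d i| ≤ 1) : |planeDet d w| ≤ |w 0| + |w 1| := by
  unfold planeDet
  refine (abs_sub _ _).trans ?_
  rw [abs_mul, abs_mul]
  nlinarith [hd 0, hd 1, abs_nonneg (w 0), abs_nonneg (w 1)]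

theorem mem_closedCone_iff {v w : Plane} (h : planeDet v w ≠ 0) (z : Plane) :
    z ∈ closedCone v w ↔ 0 ≤ planeDet z w / planeDet v w ∧ 0 ≤ planeDet v z / planeDet v w := by
  constructor
  · rintro ⟨s, t, hs, ht, rfl⟩
    have h1 : planeDet (s • v + t • w) w = s * planeDet v w := by simp [planeDet]; ring
    have h2 : planeDet v (s • v + t • w) = t * planeDet v w := by simp [planeDet]; ring
    rw [h1, h2, mul_div_cancel_right₀ _ h, mul_div_cancel_right₀ _ h]
    exact ⟨hs, ht⟩
  · rintro ⟨h1, h2⟩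
    refine ⟨_, _, h1, h2, ?_⟩
    rw [div_eq_inv_mul, div_eq_inv_mul, mul_smul, mul_smul, ← smul_add, ← cramer,
      inv_smul_smul₀ h]

theorem convex_closedCone (v w : Plane) : Convex ℝ (closedCone v w) := by
  rintro _ ⟨s, t, hs, ht, rfl⟩ _ ⟨s', t', hs', ht', rfl⟩ a b ha hb -
  exact ⟨a * s + b * s', a * t + b * t', by positivity, by positivity, by module⟩

theorem smul_mem_closedCone {v w z : Plane} (hz : z ∈ closedCone v w) {r : ℝ} (hr : 0 ≤ r) :
    r • z ∈ closedCone v w := by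
  obtain ⟨s, t, hs, ht, rfl⟩ := hz
  exact ⟨r * s, r * t, by positivity, by positivity, by module⟩

theorem isClosed_closedCone {v w : Plane} (h : planeDet v w ≠ 0) :
    IsClosed (closedCone v w) := by
  have : closedCone v w = {z | 0 ≤ planeDet z w / planeDet v w} ∩
      {z | 0 ≤ planeDet v z / planeDet v w} := by
    ext z; exact mem_closedCone_iff h z
  rw [this]
  unfold planeDet
  exact (isClosed_le (by fun_prop) (by fun_prop)).inter (isClosed_le (by fun_prop) (by fun_prop))

/-- The nonzero integer points of a cone. -/
def conePoints (v w : Plane) : Set Plane := {z | z ∈ closedCone v w ∧ IsIntegerPoint z ∧ z ≠ 0}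

theorem sail_eq (v w : Plane) : sail v w = frontier (convexHull ℝ (conePoints v w)) := rfl

theorem IsIntegerPoint.add {x y : Plane} (hx : IsIntegerPoint x) (hy : IsIntegerPoint y) :
    IsIntegerPoint (x + y) := fun i => by
  obtain ⟨m, hm⟩ := hx i
  obtain ⟨n, hn⟩ := hy i
  exact ⟨m + n, by simp [hm, hn]⟩

theorem IsIntegerPoint.zsmul {x : Plane} (hx : IsIntegerPoint x) (n : ℤ) :
    IsIntegerPoint ((n : ℝ) • x) := fun i => by
  obtain ⟨m, hm⟩ := hx i
  exact ⟨n * m, by simp [hm]⟩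

/-! ### Supporting lines of sails -/

theorem closure_hull_subset_cone {v w : Plane} (h : planeDet v w ≠ 0) :
    closure (convexHull ℝ (conePoints v w)) ⊆ closedCone v w :=
  closure_minimal (convexHull_min (fun _ hz => hz.1) (convex_closedCone v w))
    (isClosed_closedCone h)

/-- Far out along v + w the cone contains a whole unit square around the axis, hence three
non-collinear integer points. -/
theorem interior_hull_nonempty {v w : Plane} (h : planeDet v w ≠ 0) :
    (interior (convexHull ℝ (conePoints v w))).Nonempty := by
  -- A displacement d with coordinates at most 1 in absolute value changes the determinants against
  -- w and v by at most |w 0| + |w 1| and |v 0| + |v 1|. Both are then less than N |det(v, w)|.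
  obtain ⟨N, hN⟩ := exists_nat_gt ((|w 0| + |w 1| + (|v 0| + |v 1|)) / |planeDet v w|)
  rw [div_lt_iff₀ (abs_pos.2 h)] at hN
  have hmem : ∀ z : Plane, IsIntegerPoint z → (∀ i, |z i - N * (v i + w i)| ≤ 1) →
      z ∈ conePoints v w := by
    intro z hz hd
    set d : Plane := z - (N : ℝ) • (v + w) with hd_def
    have hd' : ∀ i, |d i| ≤ 1 := fun i => by simpa [hd_def, mul_add] using hd i
    have e1 : planeDet z w = N * planeDet v w + planeDet d w := by
      simp [planeDet, hd_def]; ring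
    have e2 : planeDet v z = N * planeDet v w + planeDet v d := by
      simp [planeDet, hd_def]; ring
    have b1 := abs_planeDet_le (w := w) hd'
    have b2 := abs_planeDet_le (w := v) hd'
    have e3 : planeDet v d = - planeDet d v := by simp [planeDet]; ring
    have p1 : 0 < planeDet z w / planeDet v w := by
      rw [e1, add_div, mul_div_cancel_right₀ _ h]
      have : |planeDet d w / planeDet v w| < N := by
        rw [abs_div, div_lt_iff₀ (abs_pos.2 h)]
        linarith [abs_nonneg (v 0), abs_nonneg (v 1)]
      linarith [(abs_lt.1 this).1]
    have p2 : 0 < planeDet v z / planeDet v w := by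
      rw [e2, e3, add_div, mul_div_cancel_right₀ _ h]
      have : |-planeDet d v / planeDet v w| < N := by
        rw [abs_div, abs_neg, div_lt_iff₀ (abs_pos.2 h)]
        linarith [abs_nonneg (w 0), abs_nonneg (w 1)]
      linarith [(abs_lt.1 this).1]
    refine ⟨(mem_closedCone_iff h z).2 ⟨p1.le, p2.le⟩, hz, ?_⟩
    rintro rfl
    simp [planeDet] at p1
  set m : Fin 2 → ℤ := fun i => ⌊N * (v i + w i)⌋ with hm
  have hm1 : ∀ i, (m i : ℝ) ≤ N * (v i + w i) := fun i => Int.floor_le _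
  have hm2 : ∀ i, N * (v i + w i) < (m i : ℝ) + 1 := fun i => Int.lt_floor_add_one _
  have q0 : (!₂[(m 0 : ℝ), (m 1 : ℝ)] : Plane) ∈ conePoints v w := by
    refine hmem _ (fun i => ⟨m i, by fin_cases i <;> rfl⟩) fun i => abs_le.2 ?_
    fin_cases i <;> simp <;> constructor <;> linarith [hm1 0, hm1 1, hm2 0, hm2 1]
  have q1 : (!₂[(m 0 : ℝ) + 1, (m 1 : ℝ)] : Plane) ∈ conePoints v w := by
    refine hmem _ (fun i => ⟨m i + ![1, 0] i, by fin_cases i <;> simp⟩) fun i => abs_le.2 ?_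
    fin_cases i <;> simp <;> constructor <;> linarith [hm1 0, hm1 1, hm2 0, hm2 1]
  have q2 : (!₂[(m 0 : ℝ), (m 1 : ℝ) + 1] : Plane) ∈ conePoints v w := by
    refine hmem _ (fun i => ⟨m i + ![0, 1] i, by fin_cases i <;> simp⟩) fun i => abs_le.2 ?_
    fin_cases i <;> simp <;> constructor <;> linarith [hm1 0, hm1 1, hm2 0, hm2 1]
  have hopen : IsOpen ({z : Plane | (m 0 : ℝ) < z 0} ∩ ({z : Plane | (m 1 : ℝ) < z 1} ∩
      {z : Plane | z 0 + z 1 < m 0 + m 1 + 1})) :=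
    (isOpen_lt (by fun_prop) (by fun_prop)).inter
      ((isOpen_lt (by fun_prop) (by fun_prop)).inter (isOpen_lt (by fun_prop) (by fun_prop)))
  refine ⟨!₂[(m 0 : ℝ) + 1 / 3, (m 1 : ℝ) + 1 / 3], mem_interior.2 ⟨_, ?_, hopen, ?_⟩⟩
  · rintro z ⟨h0, h1, h2⟩
    simp only [mem_ofPred_eq] at h0 h1 h2
    have hz : z = ∑ i, ![1 - (z 0 - m 0) - (z 1 - m 1), z 0 - m 0, z 1 - m 1] i •
        (![!₂[(m 0 : ℝ), (m 1 : ℝ)], !₂[(m 0 : ℝ) + 1, (m 1 : ℝ)],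
          !₂[(m 0 : ℝ), (m 1 : ℝ) + 1]] i : Plane) := by
      apply Plane.ext <;> simp [Fin.sum_univ_three] <;> ring
    rw [hz]
    refine (convex_convexHull ℝ _).sum_mem (fun i _ => ?_) ?_ fun i _ => ?_
    · fin_cases i <;> simp <;> linarith
    · simp [Fin.sum_univ_three]; ring
    · apply subset_convexHull
      fin_cases i
      · exact q0
      · exact q1
      · exact q2
  · refine ⟨?_, ?_, ?_⟩
    · simp
    · simp
    · simp only [mem_ofPred_eq]
      norm_num
      linarith

/-- An edge with integer endpoints lies on a supporting line that misses the origin, and contains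
all integer points of the cone on that line. -/
theorem exists_support {v w A B : Plane} (h : planeDet v w ≠ 0) (hA : IsIntegerPoint A)
    (hB : IsIntegerPoint B) (hAB : A ≠ B) (hE : IsEdge (sail v w) (segment ℝ A B)) :
    ∃ (g : Plane →L[ℝ] ℝ) (c : ℝ), 0 < c ∧ g A = c ∧ g B = c ∧ (∀ z ∈ conePoints v w, c ≤ g z) ∧
      A ∈ closedCone v w ∧ B ∈ closedCone v w ∧
      ∀ r : ℝ, IsIntegerPoint (A + r • (B - A)) → A + r • (B - A) ∈ closedCone v w →
        A + r • (B - A) ∈ segment ℝ A B := by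
  obtain ⟨⟨H, -, hH⟩, -⟩ := hE
  rw [sail_eq] at hH
  set K := convexHull ℝ (conePoints v w) with hK
  have hint : (interior K).Nonempty := interior_hull_nonempty h
  have hconv : Convex ℝ K := convex_convexHull ℝ _
  have hFS : segment ℝ A B ⊆ (H : Set Plane) ∩ frontier K := hH.le
  have hAF := hFS (left_mem_segment ℝ A B)
  have hBF := hFS (right_mem_segment ℝ A B)
  have hMF := hFS (midpoint_mem_segment A B)
  -- Supporting at the midpoint, rather than at an endpoint, forces f to take its maximum over the
  -- closed hull at both endpoints: neither exceeds the value at the midpoint, which is their mean.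
  obtain ⟨f, hf⟩ := geometric_hahn_banach_open_point hconv.interior isOpen_interior hMF.2.2
  have hfc : ∀ z ∈ closure K, f z ≤ f (midpoint ℝ A B) := by
    rw [← hconv.closure_interior_eq_closure_of_nonempty_interior hint]
    exact closure_minimal (fun z hz => (hf z hz).le)
      (isClosed_le f.continuous continuous_const)
  have hfM : f (midpoint ℝ A B) = (f A + f B) / 2 := by
    rw [midpoint_eq_smul_add, map_smul, map_add]
    simp
    ring
  have hfA := hfc A hAF.2.1
  have hfB := hfc B hBF.2.1
  have hAC := closure_hull_subset_cone h hAF.2.1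
  have hBC := closure_hull_subset_cone h hBF.2.1
  have hX : ∀ z ∈ conePoints v w, -f (midpoint ℝ A B) ≤ (-f) z := fun z hz =>
    neg_le_neg (hfc z (subset_closure (subset_convexHull ℝ _ hz)))
  have hline : ∀ r : ℝ, A + r • (B - A) ∈ H := fun r => by
    have := AffineMap.lineMap_mem r hAF.1 hBF.1
    rwa [AffineMap.lineMap_apply, vsub_eq_sub, vadd_eq_add, add_comm] at this
  have hseg : ∀ r : ℝ, A + r • (B - A) ∈ conePoints v w → A + r • (B - A) ∈ segment ℝ A B := by
    intro r hr
    have hr' := subset_convexHull ℝ _ hr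
    rw [hH]
    refine ⟨hline r, subset_closure hr', fun hi => ?_⟩
    have := hf _ hi
    rw [map_add, map_smul, map_sub, show f B = f A by linarith, sub_self, smul_zero, add_zero]
      at this
    linarith
  -- An endpoint may a priori be 0, since it is only known to lie in the closed cone, so a nonzero
  -- endpoint C is chosen. The cone point 2C gives c ≤ 2c, hence c ≥ 0. If c were 0, the line AB
  -- would pass through the origin and all positive integer multiples of C would lie in the bounded
  -- segment.
  have hpos : 0 < -f (midpoint ℝ A B) := by
    obtain ⟨C, hC0, hCC, hCI, hfC, hCl⟩ : ∃ C : Plane, C ≠ 0 ∧ C ∈ closedCone v w ∧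
        IsIntegerPoint C ∧ f C = f (midpoint ℝ A B) ∧ (C = A ∨ C = B) := by
      by_cases hA0 : A = 0
      · exact ⟨B, fun hB0 => hAB (hA0.trans hB0.symm), hBC, hB, by linarith, Or.inr rfl⟩
      · exact ⟨A, hA0, hAC, hA, by linarith, Or.inl rfl⟩
    have hn : ∀ n : ℕ, ((n + 1 : ℕ) : ℝ) • C ∈ conePoints v w := fun n =>
      ⟨smul_mem_closedCone hCC (by positivity), by exact_mod_cast hCI.zsmul (n + 1 : ℕ),
        smul_ne_zero (by positivity) hC0⟩
    by_contra hneg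
    have h2 := hX _ (hn 1)
    rw [map_smul] at h2
    simp only [neg_apply, hfC] at h2
    push_cast [smul_eq_mul] at h2
    have hM0 : f (midpoint ℝ A B) = 0 := by linarith
    have hfA0 : f A = 0 := by linarith
    have hfB0 : f B = 0 := by linarith
    -- Otherwise f vanishes on a basis, hence identically, whereas it is strictly negative on the
    -- interior of the hull.
    have hdet : planeDet A B = 0 := by
      by_contra hne
      obtain ⟨a, ha⟩ := hint
      have h3 := hf a ha
      have h4 : planeDet A B * f a = 0 := by
        have := congrArg f (cramer A B a)
        simpa [hfA0, hfB0] using this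
      rw [(mul_eq_zero.1 h4).resolve_left hne, hM0] at h3
      exact lt_irrefl _ h3
    have hdet' : ∀ r : ℝ, planeDet (B - A) (r • C - A) = 0 := by
      intro r
      unfold planeDet at hdet ⊢
      rcases hCl with rfl | rfl <;> simp <;> linear_combination (r - 1 : ℝ) * (-hdet)
    obtain ⟨n, hn'⟩ := exists_nat_gt ((‖A‖ + ‖B‖) / ‖C‖)
    rw [div_lt_iff₀ (norm_pos_iff.2 hC0)] at hn'
    obtain ⟨r, hr⟩ := exists_smul_of_planeDet_eq_zero (sub_ne_zero.2 hAB.symm)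
      (hdet' ((n + 1 : ℕ) : ℝ))
    have hr' : ((n + 1 : ℕ) : ℝ) • C = A + r • (B - A) := by rw [← hr]; abel
    have h5 := hseg r (hr' ▸ hn n)
    have h6 : segment ℝ A B ⊆ Metric.closedBall 0 (‖A‖ + ‖B‖) :=
      (convex_closedBall _ _).segment_subset (by simp) (by simp)
    have h7 := h6 h5
    rw [← hr', mem_closedBall_zero_iff, norm_smul, Real.norm_natCast] at h7
    push_cast at h7
    linarith [norm_nonneg C]
  refine ⟨-f, -f (midpoint ℝ A B), hpos, ?_, ?_, hX, hAC, hBC, fun r hI hC => hseg r ⟨hC, hI, ?_⟩⟩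
  · simp only [neg_apply]; linarith
  · simp only [neg_apply]; linarith
  · intro h0
    have := congrArg f h0
    rw [map_add, map_smul, map_sub, show f B = f A by linarith, sub_self, smul_zero, add_zero,
      map_zero] at this
    linarith

/-! ### Integer length -/

theorem IsIntegerPoint.sub {x y : Plane} (hx : IsIntegerPoint x) (hy : IsIntegerPoint y) :
    IsIntegerPoint (x - y) := by
  have := hx.add (hy.zsmul (-1))
  convert this using 1
  simp [sub_eq_add_neg]

/-- A primitive integer vector. -/
def IsPrimitive (e : Plane) : Prop := ∃ m n : ℤ, e 0 = m ∧ e 1 = n ∧ IsCoprime m n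

theorem IsPrimitive.isIntegerPoint {e : Plane} (he : IsPrimitive e) : IsIntegerPoint e := by
  obtain ⟨m, n, hm, hn, -⟩ := he
  intro i
  fin_cases i
  · exact ⟨m, hm⟩
  · exact ⟨n, hn⟩

theorem IsPrimitive.ne_zero {e : Plane} (he : IsPrimitive e) : e ≠ 0 := by
  obtain ⟨m, n, hm, hn, h⟩ := he
  rintro rfl
  have hm' : m = 0 := by simpa using hm.symm
  have hn' : n = 0 := by simpa using hn.symm
  subst hm' hn'
  simp [isCoprime_zero_left] at h

theorem IsPrimitive.exists_int {e : Plane} (he : IsPrimitive e) {r : ℝ}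
    (hr : IsIntegerPoint (r • e)) : ∃ n : ℤ, r = n := by
  obtain ⟨m, n, hm, hn, u, v, h⟩ := he
  obtain ⟨a, ha⟩ := hr 0
  obtain ⟨b, hb⟩ := hr 1
  refine ⟨u * a + v * b, ?_⟩
  have h' : (u * m + v * n : ℝ) = 1 := by exact_mod_cast h
  simp only [PiLp.smul_apply, smul_eq_mul, hm, hn] at ha hb
  push_cast
  linear_combination (-r) * h' + u * ha + v * hb

theorem exists_primitive {A B : Plane} (hA : IsIntegerPoint A) (hB : IsIntegerPoint B)
    (hAB : A ≠ B) : ∃ (e : Plane) (d : ℕ), 0 < d ∧ IsPrimitive e ∧ B = A + (d : ℝ) • e := by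
  have hd := hB.sub hA
  obtain ⟨m, hm⟩ := hd 0
  obtain ⟨n, hn⟩ := hd 1
  have hmn : 0 < Int.gcd m n := by
    rw [Int.gcd_pos_iff]
    by_contra! hcon
    obtain ⟨rfl, rfl⟩ := hcon
    exact hAB (sub_eq_zero.1 (Plane.ext (by simpa using hm) (by simpa using hn))).symm
  obtain ⟨m', n', hc, h1, h2⟩ := Int.exists_gcd_one hmn
  refine ⟨!₂[(m' : ℝ), (n' : ℝ)], Int.gcd m n, hmn, ⟨m', n', rfl, rfl,
    Int.isCoprime_iff_gcd_eq_one.2 hc⟩, ?_⟩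
  rw [← sub_eq_iff_eq_add']
  refine Plane.ext ?_ ?_
  · rw [hm]
    conv_lhs => rw [h1]
    simp [mul_comm]
  · rw [hn]
    conv_lhs => rw [h2]
    simp [mul_comm]

theorem mem_segment_add_smul_iff {A e z : Plane} {d : ℝ} (hd : 0 < d) :
    z ∈ segment ℝ A (A + d • e) ↔ ∃ r ∈ Icc 0 d, z = A + r • e := by
  rw [segment_eq_image']
  constructor
  · rintro ⟨t, ⟨h0, h1⟩, rfl⟩
    exact ⟨t * d, ⟨by positivity, by nlinarith⟩, by simp only [add_sub_cancel_left, smul_smul]⟩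
  · rintro ⟨r, ⟨h0, h1⟩, rfl⟩
    refine ⟨r / d, ⟨by positivity, by rwa [div_le_one hd]⟩, ?_⟩
    simp only [add_sub_cancel_left, smul_smul]
    rw [div_mul_cancel₀ _ hd.ne']

theorem integerLength_primitive {A e : Plane} (hA : IsIntegerPoint A) (he : IsPrimitive e) {d : ℕ}
    (hd : 0 < d) : integerLength A (A + (d : ℝ) • e) = d := by
  have hd1 : (1 : ℝ) ≤ d := by exact_mod_cast hd
  have hd0 : (0 : ℝ) < d := by linarith
  have hne : 0 < ‖e‖ := norm_pos_iff.2 he.ne_zero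
  have hl : IsLeast {r : ℝ | ∃ P ∈ segment ℝ A (A + (d : ℝ) • e),
      ∃ Q ∈ segment ℝ A (A + (d : ℝ) • e),
      IsIntegerPoint P ∧ IsIntegerPoint Q ∧ P ≠ Q ∧ r = dist P Q} ‖e‖ := by
    constructor
    · refine ⟨A, left_mem_segment ℝ _ _, A + e, ?_, hA, hA.add he.isIntegerPoint, ?_, ?_⟩
      · exact (mem_segment_add_smul_iff hd0).2 ⟨1, ⟨zero_le_one, hd1⟩, by rw [one_smul]⟩
      · simpa using he.ne_zero
      · simp [dist_eq_norm]
    · rintro _ ⟨P, hP, Q, hQ, hPI, hQI, hPQ, rfl⟩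
      obtain ⟨p, -, rfl⟩ := (mem_segment_add_smul_iff hd0).1 hP
      obtain ⟨q, -, rfl⟩ := (mem_segment_add_smul_iff hd0).1 hQ
      have hsub : A + p • e - (A + q • e) = (p - q) • e := by module
      obtain ⟨n, hn⟩ := he.exists_int (hsub ▸ hPI.sub hQI)
      have hn0 : n ≠ 0 := by
        rintro rfl
        apply hPQ
        rw [← sub_eq_zero, hsub, hn]
        simp
      have : (1 : ℝ) ≤ |(n : ℝ)| := by exact_mod_cast Int.one_le_abs hn0
      rw [dist_eq_norm, hsub, norm_smul, hn, Real.norm_eq_abs]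
      exact le_mul_of_one_le_left hne.le this
  unfold integerLength
  rw [hl.csInf_eq, dist_self_add_right, norm_smul, Real.norm_natCast,
    mul_div_cancel_right₀ _ hne.ne']

/-- The point sought is an integer point whose determinant with e is D - 1, where D is that of a.
Such points form a coset of ℤe, and reduction modulo D selects one between the rays through a and a
+ e. -/
theorem exists_triangle_int_of_pos (a₀ a₁ e₀ e₁ : ℤ) (he : IsCoprime e₀ e₁)
    (hD : 0 < a₀ * e₁ - a₁ * e₀) :
    ∃ z₀ z₁ m : ℤ, 0 ≤ m ∧ m ≤ a₀ * e₁ - a₁ * e₀ - 1 ∧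
      (a₀ * e₁ - a₁ * e₀) * z₀ = (a₀ * e₁ - a₁ * e₀ - 1) * a₀ + m * e₀ ∧
      (a₀ * e₁ - a₁ * e₀) * z₁ = (a₀ * e₁ - a₁ * e₀ - 1) * a₁ + m * e₁ := by
  obtain ⟨u, v, h⟩ := he
  set D := a₀ * e₁ - a₁ * e₀ with hDd
  have h1 := Int.emod_add_mul_ediv (v * a₁ + u * a₀) D
  set m := (v * a₁ + u * a₀) % D
  set q := (v * a₁ + u * a₀) / D
  -- The Bézout vector (v, -u) has determinant 1 with e. Subtracting it from a lowers the
  -- determinant by one, and the multiple q of e brings m into [0, D).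
  refine ⟨a₀ - (v + q * e₀), a₁ - (-u + q * e₁), m, Int.emod_nonneg _ hD.ne', ?_, ?_, ?_⟩
  · have := Int.emod_lt_of_pos (v * a₁ + u * a₀) hD
    change m < D at this
    omega
  · linear_combination (-e₀) * h1 - v * hDd + (-a₀) * h
  · linear_combination (-e₁) * h1 + u * hDd + (-a₁) * h

/-- A triangle whose vertices are the origin and the endpoints of a primitive segment contains a
further nonzero integer point unless the segment is at integer distance one from the origin. -/
theorem exists_triangle_point {A e : Plane} (hA : IsIntegerPoint A) (he : IsPrimitive e)
    (h0 : planeDet A e ≠ 0) (h1 : |planeDet A e| ≠ 1) :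
    ∃ (z : Plane) (s t : ℝ), IsIntegerPoint z ∧ z ≠ 0 ∧ 0 ≤ s ∧ 0 ≤ t ∧ s + t < 1 ∧
      z = s • A + t • (A + e) := by
  obtain ⟨a₀, ha₀⟩ := hA 0
  obtain ⟨a₁, ha₁⟩ := hA 1
  obtain ⟨e₀, e₁, he₀, he₁, hc⟩ := he
  have hdet : planeDet A e = ((a₀ * e₁ - a₁ * e₀ : ℤ) : ℝ) := by
    simp [planeDet, ha₀, ha₁, he₀, he₁]
  rw [hdet] at h0 h1
  have key : ∀ {D : ℤ}, 0 < D → |(a₀ * e₁ - a₁ * e₀ : ℤ)| = D → ∀ z₀ z₁ m : ℤ, 0 ≤ m → m ≤ D - 1 →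
      D * z₀ = (D - 1 - m) * a₀ + m * (a₀ + e₀) → D * z₁ = (D - 1 - m) * a₁ + m * (a₁ + e₁) →
      ∃ (z : Plane) (s t : ℝ), IsIntegerPoint z ∧ z ≠ 0 ∧ 0 ≤ s ∧ 0 ≤ t ∧ s + t < 1 ∧
      z = s • A + t • (A + e) := by
    intro D hD hDa z₀ z₁ m hm hmD hz₀ hz₁
    have hD1 : D ≠ 1 := by
      rintro rfl
      exact h1 (by exact_mod_cast hDa)
    have hD' : (0 : ℝ) < D := by exact_mod_cast hD
    have hm' : (0 : ℝ) ≤ m := by exact_mod_cast hm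
    have hmD' : (m : ℝ) ≤ D - 1 := by exact_mod_cast hmD
    have hz₀' : (D * z₀ : ℝ) = (D - 1 - m) * a₀ + m * (a₀ + e₀) := by exact_mod_cast hz₀
    have hz₁' : (D * z₁ : ℝ) = (D - 1 - m) * a₁ + m * (a₁ + e₁) := by exact_mod_cast hz₁
    refine ⟨!₂[(z₀ : ℝ), (z₁ : ℝ)], (D - 1 - m) / D, m / D, ?_, ?_,
      div_nonneg (by linarith) hD'.le, by positivity, ?_, ?_⟩
    · intro i
      fin_cases i
      · exact ⟨z₀, rfl⟩
      · exact ⟨z₁, rfl⟩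
    · intro hz
      have hz0 : (z₀ : ℝ) = 0 := by simpa using congrArg (fun p : Plane => p 0) hz
      have hz1 : (z₁ : ℝ) = 0 := by simpa using congrArg (fun p : Plane => p 1) hz
      have hz0' : z₀ = 0 := by exact_mod_cast hz0
      have hz1' : z₁ = 0 := by exact_mod_cast hz1
      rw [hz0'] at hz₀
      rw [hz1'] at hz₁
      have h3 : (D - 1) * (a₀ * e₁ - a₁ * e₀) = 0 := by
        linear_combination (-e₁) * hz₀ + e₀ * hz₁
      rcases mul_eq_zero.1 h3 with h4 | h4
      · omega
      · rw [h4] at hDa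
        simp at hDa
        omega
    · rw [← add_div, div_lt_one hD']
      linarith
    · refine Plane.ext ?_ ?_
      · simp [ha₀, he₀]
        field_simp
        linear_combination hz₀'
      · simp [ha₁, he₁]
        field_simp
        linear_combination hz₁'
  rcases lt_trichotomy (a₀ * e₁ - a₁ * e₀) 0 with hneg | hzero | hpos
  -- Negative orientation: the same triangle is read from its other vertex, with A + e and -e in
  -- place of A and e, which turns m into D - 1 - m.
  · obtain ⟨z₀, z₁, m, hm, hmD, hz₀, hz₁⟩ := exists_triangle_int_of_pos (a₀ + e₀) (a₁ + e₁)
      (-e₀) (-e₁) hc.neg_neg (by linarith)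
    refine key (D := -(a₀ * e₁ - a₁ * e₀)) (by linarith) (abs_of_neg hneg) z₀ z₁
      (-(a₀ * e₁ - a₁ * e₀) - 1 - m) (by linarith) (by linarith) ?_ ?_
    · linear_combination hz₀
    · linear_combination hz₁
  · exact absurd (by exact_mod_cast hzero) h0
  · obtain ⟨z₀, z₁, m, hm, hmD, hz₀, hz₁⟩ := exists_triangle_int_of_pos a₀ a₁ e₀ e₁ hc hpos
    refine key hpos (abs_of_pos hpos) z₀ z₁ m hm hmD ?_ ?_
    · linear_combination hz₀
    · linear_combination hz₁

/-! ### Edges of sails -/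

theorem isPrimitive_of_planeDet {A e : Plane} (hA : IsIntegerPoint A) (he : IsIntegerPoint e)
    (hdet : |planeDet A e| = 1) : IsPrimitive e := by
  obtain ⟨a₀, ha₀⟩ := hA 0
  obtain ⟨a₁, ha₁⟩ := hA 1
  obtain ⟨m, hm⟩ := he 0
  obtain ⟨n, hn⟩ := he 1
  refine ⟨m, n, hm, hn, ?_⟩
  have h : |a₀ * n - a₁ * m| = 1 := by
    simp only [planeDet, ha₀, ha₁, hm, hn] at hdet
    exact_mod_cast hdet
  rcases (abs_eq zero_le_one).1 h with h | h
  · exact ⟨-a₁, a₀, by linear_combination h⟩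
  · exact ⟨a₁, -a₀, by linear_combination -h⟩

theorem Line.eq_mk {L : Line} {v : Plane} (hv : v ∈ L.submodule) (h0 : v ≠ 0) :
    L = Projectivization.mk ℝ v h0 := by
  induction L using Projectivization.ind with
  | h u hu =>
    rw [Projectivization.submodule_mk, Submodule.mem_span_singleton] at hv
    exact ((Projectivization.mk_eq_mk_iff' ℝ _ _ h0 hu).2 hv).symm

theorem planeDet_ne_zero_of_ne {L M : Line} (hLM : L ≠ M) {v w : Plane} (hv : v ∈ L.submodule)
    (hv0 : v ≠ 0) (hw : w ∈ M.submodule) (hw0 : w ≠ 0) : planeDet v w ≠ 0 := by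
  intro h
  obtain ⟨r, hr⟩ := exists_smul_of_planeDet_eq_zero hv0 h
  apply hLM
  rw [Line.eq_mk (hr ▸ L.submodule.smul_mem r hv : w ∈ L.submodule) hw0, Line.eq_mk hw hw0]

/-- The endpoints of an edge of integer length `k` are `A` and `A + k e` with `A`, `e` a basis of
the integer lattice. -/
theorem exists_basis_of_edge {A B : Plane} (hA : IsIntegerPoint A) (hB : IsIntegerPoint B) {k : ℕ}
    (hk : 0 < k) (hl : integerLength A B = k) (hne : (withEdge (segment ℝ A B)).Nonempty) :
    ∃ e : Plane, IsIntegerPoint e ∧ |planeDet A e| = 1 ∧ B = A + (k : ℝ) • e := by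
  have hAB : A ≠ B := by
    rintro rfl
    simp only [integerLength, dist_self, zero_div] at hl
    exact hk.ne (by exact_mod_cast hl)
  obtain ⟨e, d, hd, he, rfl⟩ := exists_primitive hA hB hAB
  rw [integerLength_primitive hA he hd, Nat.cast_inj] at hl
  subst hl
  refine ⟨e, he.isIntegerPoint, ?_, rfl⟩
  obtain ⟨_, c, -, v, w, hv, hv0, hw, hw0, hE⟩ := hne
  have hdet := planeDet_ne_zero_of_ne c.2 hv hv0 hw hw0
  obtain ⟨g, γ, hγ, hgA, hgB, hX, hAC, hBC, -⟩ := exists_support hdet hA hB hAB hE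
  have hge : g e = 0 := by
    have hd' : (d : ℝ) ≠ 0 := by exact_mod_cast hd.ne'
    rw [map_add, map_smul, hgA, add_eq_left, smul_eq_mul] at hgB
    exact (mul_eq_zero.1 hgB).resolve_left hd'
  by_contra h1
  have h0 : planeDet A e ≠ 0 := by
    intro h0
    have h0' : planeDet e A = 0 := by unfold planeDet at h0 ⊢; linarith
    obtain ⟨r, hr⟩ := exists_smul_of_planeDet_eq_zero he.ne_zero h0'
    rw [hr, map_smul, hge, smul_zero] at hgA
    exact hγ.ne hgA
  -- At this further integer point of the cone the supporting functional is (s+t)γ < γ, a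
  -- contradiction.
  obtain ⟨z, s, t, hz, hz0, hs, ht, hst, rfl⟩ := exists_triangle_point hA he h0 h1
  have hAe : A + e ∈ closedCone v w := by
    refine (convex_closedCone v w).segment_subset hAC hBC
      ((mem_segment_add_smul_iff (by positivity)).2 ⟨1, ⟨zero_le_one, ?_⟩, by rw [one_smul]⟩)
    exact_mod_cast hd
  have hzC : s • A + t • (A + e) ∈ closedCone v w := by
    obtain ⟨s₁, t₁, hs₁, ht₁, e₁⟩ := smul_mem_closedCone hAC hs
    obtain ⟨s₂, t₂, hs₂, ht₂, e₂⟩ := smul_mem_closedCone hAe ht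
    exact ⟨s₁ + s₂, t₁ + t₂, by positivity, by positivity, by rw [e₁, e₂]; module⟩
  have := hX _ ⟨hzC, hz, hz0⟩
  rw [map_add, map_smul, map_smul, map_add, hge, hgA, add_zero, smul_eq_mul, smul_eq_mul] at this
  nlinarith

/-- The lines through the origin and the points `A + s e` with `s ∈ I`. -/
def slopeSet (A e : Plane) (I : Set ℝ) : Set Line := {L | ∃ s ∈ I, A + s • e ∈ L.submodule}

/-- In the basis v, w both coordinates of A + se are affine in s and nonnegative on [0, k]. The
integer points at s = -1 and s = k+1 are outside the cone, so some coordinate is negative at each.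
The zeros of the coordinates are the parameters where the line A + se meets the two given lines. -/
theorem mem_slopeSets_of_isEdge {A e : Plane} {k : ℕ} (hk : 0 < k) (hA : IsIntegerPoint A)
    (he : IsIntegerPoint e) (he0 : e ≠ 0) {L M : Line} (hLM : L ≠ M) {v w : Plane}
    (hv : v ∈ L.submodule) (hv0 : v ≠ 0) (hw : w ∈ M.submodule) (hw0 : w ≠ 0)
    (hE : IsEdge (sail v w) (segment ℝ A (A + (k : ℝ) • e))) :
    (L ∈ slopeSet A e (Ioc (-1) 0) ∧ M ∈ slopeSet A e (Ico k (k + 1))) ∨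
      (L ∈ slopeSet A e (Ico k (k + 1)) ∧ M ∈ slopeSet A e (Ioc (-1) 0)) := by
  have hk0 : (0 : ℝ) < k := by exact_mod_cast hk
  have hdet := planeDet_ne_zero_of_ne hLM hv hv0 hw hw0
  have hB : IsIntegerPoint (A + (k : ℝ) • e) := hA.add (by exact_mod_cast he.zsmul k)
  obtain ⟨g, γ, -, -, -, -, hAC, hBC, hlast⟩ := exists_support hdet hA hB
    (by simpa using ⟨hk.ne', he0⟩) hE
  have hout : ∀ n : ℤ, A + (n : ℝ) • e ∈ closedCone v w → (0 : ℝ) ≤ n ∧ (n : ℝ) ≤ k := by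
    intro n hn
    have e1 : A + (n / k : ℝ) • (A + (k : ℝ) • e - A) = A + (n : ℝ) • e := by
      rw [add_sub_cancel_left, smul_smul, div_mul_cancel₀ _ hk0.ne']
    have h1 := hlast (n / k) (e1 ▸ hA.add (he.zsmul n)) (e1 ▸ hn)
    rw [e1] at h1
    obtain ⟨r, hr, hr'⟩ := (mem_segment_add_smul_iff hk0).1 h1
    rw [add_right_inj] at hr'
    rw [smul_left_injective ℝ he0 hr']
    exact hr
  have hm1 : A + (-1 : ℝ) • e ∉ closedCone v w := fun h => by
    have := hout (-1) (by exact_mod_cast h)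
    norm_num at this
  have hp1 : A + (k + 1 : ℝ) • e ∉ closedCone v w := fun h => by
    have := (hout (k + 1) (by exact_mod_cast h)).2
    push_cast at this
    linarith
  obtain ⟨a₀, b₀, ha₀, hb₀, rfl⟩ := hAC
  obtain ⟨a', b', ha', hb', hB'⟩ := hBC
  obtain ⟨a₁, ha₁⟩ : ∃ a₁, a' = a₀ + k * a₁ := ⟨(a' - a₀) / k, by field_simp; ring⟩
  obtain ⟨b₁, hb₁⟩ : ∃ b₁, b' = b₀ + k * b₁ := ⟨(b' - b₀) / k, by field_simp; ring⟩
  have hek : e = a₁ • v + b₁ • w := by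
    have h1 : (k : ℝ) • e = (k : ℝ) • (a₁ • v + b₁ • w) := by
      rw [← add_right_inj (a₀ • v + b₀ • w), hB', ha₁, hb₁]
      module
    exact smul_right_injective _ hk0.ne' h1
  subst hek
  have hm2 : ¬ (0 ≤ a₀ - a₁ ∧ 0 ≤ b₀ - b₁) := fun h => hm1 ⟨_, _, h.1, h.2, by module⟩
  have hp2 : ¬ (0 ≤ a₀ + (k + 1) * a₁ ∧ 0 ≤ b₀ + (k + 1) * b₁) := fun h =>
    hp1 ⟨_, _, h.1, h.2, by module⟩
  rw [ha₁] at ha'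
  rw [hb₁] at hb'
  have hcoord : ∀ s : ℝ, a₀ • v + b₀ • w + s • (a₁ • v + b₁ • w)
      = (a₀ + s * a₁) • v + (b₀ + s * b₁) • w := fun s => by module
  -- A coordinate negative at s = -1 is increasing, so it stays nonnegative at k+1. The other one
  -- must then be negative there, and each changes sign in its own unit interval.
  have main : ∀ {a₀ b₀ a₁ b₁ : ℝ}, 0 ≤ a₀ → 0 ≤ b₀ → 0 ≤ a₀ + k * a₁ → 0 ≤ b₀ + k * b₁ →
      a₀ - a₁ < 0 → ¬ (0 ≤ a₀ + (k + 1) * a₁ ∧ 0 ≤ b₀ + (k + 1) * b₁) →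
      (∃ s ∈ Ioc (-1 : ℝ) 0, a₀ + s * a₁ = 0) ∧ ∃ t ∈ Ico (k : ℝ) (k + 1), b₀ + t * b₁ = 0 := by
    intro a₀ b₀ a₁ b₁ ha₀ hb₀ ha' hb' hneg hnot
    have ha₁ : 0 < a₁ := by linarith
    have hb : b₀ + (k + 1) * b₁ < 0 := by
      by_contra hcon
      exact hnot ⟨by positivity, not_lt.1 hcon⟩
    have hb₁ : b₁ < 0 := by nlinarith
    refine ⟨⟨-a₀ / a₁, ⟨?_, ?_⟩, ?_⟩, ⟨-b₀ / b₁, ⟨?_, ?_⟩, ?_⟩⟩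
    · rw [lt_div_iff₀ ha₁]; linarith
    · exact div_nonpos_of_nonpos_of_nonneg (by linarith) ha₁.le
    · rw [div_mul_cancel₀ _ ha₁.ne']; ring
    · rw [le_div_iff_of_neg hb₁]; linarith
    · rw [div_lt_iff_of_neg hb₁]; linarith
    · rw [div_mul_cancel₀ _ hb₁.ne]; ring
  by_cases hcase : a₀ - a₁ < 0
  · obtain ⟨⟨s, hs, hs0⟩, t, ht, ht0⟩ := main ha₀ hb₀ ha' hb' hcase hp2
    refine Or.inr ⟨⟨t, ht, ?_⟩, ⟨s, hs, ?_⟩⟩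
    · rw [hcoord, ht0, zero_smul, add_zero]
      exact L.submodule.smul_mem _ hv
    · rw [hcoord, hs0, zero_smul, zero_add]
      exact M.submodule.smul_mem _ hw
  · have hcase' : b₀ - b₁ < 0 := by
      by_contra hcon
      exact hm2 ⟨not_lt.1 hcase, not_lt.1 hcon⟩
    obtain ⟨⟨s, hs, hs0⟩, t, ht, ht0⟩ := main hb₀ ha₀ hb' ha' hcase' (fun h => hp2 ⟨h.2, h.1⟩)
    refine Or.inl ⟨⟨s, hs, ?_⟩, ⟨t, ht, ?_⟩⟩
    · rw [hcoord, hs0, zero_smul, add_zero]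
      exact L.submodule.smul_mem _ hv
    · rw [hcoord, ht0, zero_smul, zero_add]
      exact M.submodule.smul_mem _ hw

/-- In lattice coordinates z = mA + ne, nonzero integer points of the cone satisfy m ≥ 1, so the
line m = 1 supports the hull. It remains to see that the closed hull meets this line in 0 ≤ n ≤ k
only. -/
theorem isEdge_of_slopes {A e : Plane} {k : ℕ} (hk : 0 < k) (hA : IsIntegerPoint A)
    (he : IsIntegerPoint e) (hdet : |planeDet A e| = 1) {s t : ℝ} (hs : s ∈ Ioc (-1 : ℝ) 0)
    (ht : t ∈ Ico (k : ℝ) (k + 1)) :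
    IsEdge (sail (A + s • e) (A + t • e)) (segment ℝ A (A + (k : ℝ) • e)) := by
  have hk0 : (0 : ℝ) < k := by exact_mod_cast hk
  have hd0 : planeDet A e ≠ 0 := fun h => by simp [h] at hdet
  have hinv : (planeDet A e)⁻¹ = planeDet A e := by
    rcases (abs_eq zero_le_one).1 hdet with h | h <;> rw [h] <;> norm_num
  have he0 : e ≠ 0 := by
    rintro rfl
    simp [planeDet] at hd0
  -- Coordinates in the basis A, e by Cramer's rule; the determinant is ±1, so dividing by it is
  -- multiplying by it.
  set m : Plane → ℝ := fun z => planeDet A e * planeDet z e with hm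
  set n : Plane → ℝ := fun z => planeDet A e * planeDet A z with hn
  have hsq : planeDet A e * planeDet A e = 1 := by
    nth_rewrite 1 [← hinv]
    exact inv_mul_cancel₀ hd0
  have hm' : ∀ a b : ℝ, m (a • A + b • e) = a := fun a b => by
    have : planeDet (a • A + b • e) e = a * planeDet A e := by simp [planeDet]; ring
    simp only [hm, this]
    linear_combination a * hsq
  have hn' : ∀ a b : ℝ, n (a • A + b • e) = b := fun a b => by
    have : planeDet A (a • A + b • e) = b * planeDet A e := by simp [planeDet]; ring
    simp only [hn, this]
    linear_combination b * hsq
  have hmc : Continuous m := by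
    simp only [hm, planeDet]; fun_prop
  have hnc : Continuous n := by
    simp only [hn, planeDet]; fun_prop
  have hmlin : ∀ (y z : Plane) (a b : ℝ), m (a • y + b • z) = a * m y + b * m z := by
    intro y z a b; simp [hm, planeDet]; ring
  have hnlin : ∀ (y z : Plane) (a b : ℝ), n (a • y + b • z) = a * n y + b * n z := by
    intro y z a b; simp [hn, planeDet]; ring
  set X := conePoints (A + s • e) (A + t • e) with hX
  have hint : ∀ {x y : Plane}, IsIntegerPoint x → IsIntegerPoint y →
      ∃ a : ℤ, planeDet x y = a := by
    intro x y hx hy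
    obtain ⟨a, ha⟩ := hx 0
    obtain ⟨b, hb⟩ := hx 1
    obtain ⟨c, hc⟩ := hy 0
    obtain ⟨d, hd⟩ := hy 1
    exact ⟨a * d - b * c, by simp [planeDet, ha, hb, hc, hd]⟩
  obtain ⟨D, hD⟩ := hint hA he
  -- The cone gives only -m < n < (k+1)m, which on m = 1 would allow -1 < n < k+1. Integrality
  -- sharpens this to 0 ≤ n ≤ k at m = 1, and the slopes k+2 and -2 are steep enough to cover all m
  -- ≥ 2. These closed linear conditions then pass to the closure of the convex hull.
  have hXmn : ∀ z ∈ X, 1 ≤ m z ∧ n z ≤ k + (k + 2) * (m z - 1) ∧ -2 * (m z - 1) ≤ n z := by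
    rintro z ⟨⟨σ, τ, hσ, hτ, hz⟩, hzI, hz0⟩
    have hz' : z = (σ + τ) • A + (σ * s + τ * t) • e := by rw [hz]; module
    obtain ⟨a, ha⟩ := hint hzI he
    obtain ⟨b, hb⟩ := hint hA hzI
    have hma : m z = ((D * a : ℤ) : ℝ) := by simp only [hm, hD, ha]; push_cast; rfl
    have hnb : n z = ((D * b : ℤ) : ℝ) := by simp only [hn, hD, hb]; push_cast; rfl
    have e1 : m z = σ + τ := by rw [hz', hm']
    have e2 : n z = σ * s + τ * t := by rw [hz', hn']
    have hpos : 0 < σ + τ := by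
      rcases hσ.eq_or_lt with h1 | h1
      · rcases hτ.eq_or_lt with h2 | h2
        · exact absurd (by rw [hz', ← h1, ← h2]; simp) hz0
        · linarith
      · linarith
    have haux : ∀ {p q : ℝ}, 0 < p → 0 < q → 0 < σ * p + τ * q := by
      intro p q hp hq
      rcases hσ.eq_or_lt with h1 | h1
      · have : 0 < τ := by linarith
        rw [← h1, zero_mul, zero_add]
        positivity
      · positivity
    have h1 : 1 ≤ D * a := by
      rw [← e1, hma] at hpos
      have : 0 < D * a := by exact_mod_cast hpos
      omega
    have h2 : n z < (k + 1) * m z := by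
      rw [e1, e2]
      linarith [haux (by linarith [hs.2] : (0 : ℝ) < k + 1 - s)
        (by linarith [ht.2] : (0 : ℝ) < k + 1 - t)]
    have h3 : - m z < n z := by
      rw [e1, e2]
      linarith [haux (by linarith [hs.1] : (0 : ℝ) < s + 1)
        (by linarith [ht.1] : (0 : ℝ) < t + 1)]
    rw [hma, hnb] at h2 h3 ⊢
    generalize D * a = M at *
    generalize D * b = N at *
    have h2' : N < (k + 1) * M := by exact_mod_cast h2
    have h3' : -M < N := by exact_mod_cast h3
    refine ⟨by exact_mod_cast h1, ?_, ?_⟩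
    · have : N ≤ k + (k + 2) * (M - 1) := by
        rcases h1.eq_or_lt with h | h
        · rw [← h] at h2' ⊢; omega
        · nlinarith
      exact_mod_cast this
    · have : -2 * (M - 1) ≤ N := by omega
      exact_mod_cast this
  have hK : ∀ z ∈ closure (convexHull ℝ X),
      1 ≤ m z ∧ n z ≤ k + (k + 2) * (m z - 1) ∧ -2 * (m z - 1) ≤ n z := by
    refine closure_minimal (t := {z | 1 ≤ m z} ∩ ({z | n z ≤ k + (k + 2) * (m z - 1)} ∩
      {z | -2 * (m z - 1) ≤ n z})) (convexHull_min hXmn ?_) ?_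
    · rintro y ⟨hy1, hy2, hy3⟩ z ⟨hz1, hz2, hz3⟩ a b ha hb hab
      simp only [mem_ofPred_eq] at hy1 hy2 hy3 hz1 hz2 hz3
      obtain rfl : b = 1 - a := by linarith
      refine ⟨?_, ?_, ?_⟩ <;> simp only [mem_ofPred_eq, hmlin, hnlin] <;>
        nlinarith [mul_le_mul_of_nonneg_left hy1 ha, mul_le_mul_of_nonneg_left hz1 hb,
          mul_le_mul_of_nonneg_left hy2 ha, mul_le_mul_of_nonneg_left hz2 hb,
          mul_le_mul_of_nonneg_left hy3 ha, mul_le_mul_of_nonneg_left hz3 hb]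
    · exact (isClosed_le (by fun_prop) (by fun_prop)).inter
        ((isClosed_le (by fun_prop) (by fun_prop)).inter
          (isClosed_le (by fun_prop) (by fun_prop)))
  have hts : 0 < t - s := by linarith [hs.2, ht.1]
  have hmemX : ∀ j : ℤ, 0 ≤ j → j ≤ k → A + (j : ℝ) • e ∈ X := by
    intro j hj0 hjk
    have hj0' : (0 : ℝ) ≤ j := by exact_mod_cast hj0
    have hjk' : (j : ℝ) ≤ k := by exact_mod_cast hjk
    refine ⟨⟨(t - j) / (t - s), (j - s) / (t - s), div_nonneg (by linarith [ht.1]) hts.le,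
      div_nonneg (by linarith [hs.2]) hts.le, ?_⟩, hA.add (he.zsmul j), ?_⟩
    · have e1 : (t - j) / (t - s) + (j - s) / (t - s) = 1 := by field_simp; ring
      have e2 : (t - j) / (t - s) * s + (j - s) / (t - s) * t = j := by field_simp; ring
      calc A + (j : ℝ) • e = ((t - j) / (t - s) + (j - s) / (t - s)) • A +
            ((t - j) / (t - s) * s + (j - s) / (t - s) * t) • e := by rw [e1, e2, one_smul]
        _ = _ := by module
    · intro h0
      have := hm' 1 j
      rw [one_smul, h0] at this
      simp [hm, planeDet] at this
  have hAX : A ∈ X := by simpa using hmemX 0 le_rfl (by positivity)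
  have hBX : A + (k : ℝ) • e ∈ X := by exact_mod_cast hmemX k (by positivity) le_rfl
  refine ⟨⟨AffineSubspace.mk' A (ℝ ∙ e), ?_, ?_⟩, A, A + (k : ℝ) • e, ?_, rfl⟩
  · rw [AffineSubspace.direction_mk', finrank_span_singleton he0]
  · rw [sail_eq]
    ext z
    constructor
    · intro hz
      have hzK : z ∈ convexHull ℝ X := (convex_convexHull ℝ X).segment_subset
        (subset_convexHull ℝ _ hAX) (subset_convexHull ℝ _ hBX) hz
      obtain ⟨r, hr, rfl⟩ := (mem_segment_add_smul_iff hk0).1 hz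
      refine ⟨?_, subset_closure hzK, fun hi => ?_⟩
      · rw [SetLike.mem_coe, AffineSubspace.mem_mk', vsub_eq_sub, add_sub_cancel_left]
        exact Submodule.smul_mem _ _ (Submodule.mem_span_singleton_self e)
      -- An interior point could be pushed slightly in the direction -A, to a point of the hull with
      -- m < 1.
      · have hc : Continuous fun ε : ℝ => (1 - ε) • A + r • e := by fun_prop
        have h0 : (fun ε : ℝ => (1 - ε) • A + r • e) ⁻¹' interior (convexHull ℝ X) ∈ 𝓝 (0 : ℝ) := by
          apply hc.continuousAt.preimage_mem_nhds
          simpa using isOpen_interior.mem_nhds hi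
        obtain ⟨ε, hε, hball⟩ := Metric.mem_nhds_iff.1 h0
        have h1 := hball (show ε / 2 ∈ Metric.ball (0 : ℝ) ε by
          rw [mem_ball_zero_iff, Real.norm_of_nonneg (by positivity)]; linarith)
        have h2 := (hK _ (subset_closure (interior_subset h1))).1
        rw [hm'] at h2
        linarith
    · rintro ⟨hzH, hz⟩
      rw [SetLike.mem_coe, AffineSubspace.mem_mk', vsub_eq_sub,
        Submodule.mem_span_singleton] at hzH
      obtain ⟨r, hr⟩ := hzH
      obtain rfl : z = A + r • e := by rw [hr]; abel
      obtain ⟨-, h2, h3⟩ := hK _ hz.1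
      have e1 := hm' 1 r
      have e2 := hn' 1 r
      rw [one_smul] at e1 e2
      rw [e1, e2] at h2 h3
      exact (mem_segment_add_smul_iff hk0).2 ⟨r, ⟨by linarith, by linarith⟩, rfl⟩
  · simpa using ⟨hk.ne', he0⟩

theorem add_smul_ne_zero {A e : Plane} (hdet : planeDet A e ≠ 0) (s : ℝ) : A + s • e ≠ 0 := by
  intro h
  apply hdet
  rw [eq_neg_of_add_eq_zero_left h]
  simp [planeDet]
  ring

/-- The continued fractions with a given edge. -/
theorem proj_mem_withEdge_iff {A e : Plane} {k : ℕ} (hk : 0 < k) (hA : IsIntegerPoint A)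
    (he : IsIntegerPoint e) (hdet : |planeDet A e| = 1) (c : FramedCF) :
    proj c ∈ withEdge (segment ℝ A (A + (k : ℝ) • e)) ↔
      (c.1.1 ∈ slopeSet A e (Ioc (-1) 0) ∧ c.1.2 ∈ slopeSet A e (Ico k (k + 1))) ∨
      (c.1.1 ∈ slopeSet A e (Ico k (k + 1)) ∧ c.1.2 ∈ slopeSet A e (Ioc (-1) 0)) := by
  have he0 := (isPrimitive_of_planeDet hA he hdet).ne_zero
  have hd0 : planeDet A e ≠ 0 := fun h => by simp [h] at hdet
  constructor
  · rintro ⟨c', hc', v, w, hv, hv0, hw, hw0, hE⟩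
    have h := mem_slopeSets_of_isEdge hk hA he he0 c'.2 hv hv0 hw hw0 hE
    rcases (Quotient.exact hc' : c'.1 = c.1 ∨ c'.1 = c.1.swap) with h1 | h1
    · rwa [h1] at h
    · rw [h1] at h
      simp only [Prod.fst_swap, Prod.snd_swap] at h
      tauto
  · rintro (⟨⟨s, hs, h1⟩, t, ht, h2⟩ | ⟨⟨t, ht, h1⟩, s, hs, h2⟩)
    · exact ⟨c, rfl, _, _, h1, add_smul_ne_zero hd0 s, h2, add_smul_ne_zero hd0 t,
        isEdge_of_slopes hk hA he hdet hs ht⟩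
    · exact ⟨⟨c.1.swap, c.2.symm⟩, Quotient.sound (Or.inr rfl), _, _, h2, add_smul_ne_zero hd0 s,
        h1, add_smul_ne_zero hd0 t, isEdge_of_slopes hk hA he hdet hs ht⟩

/-- There are edges of every integer length. -/
theorem exists_edge {k : ℕ} (hk : 0 < k) : ∃ A B : Plane, IsIntegerPoint A ∧ IsIntegerPoint B ∧
    integerLength A B = (k : ℝ) ∧ (withEdge (segment ℝ A B)).Nonempty := by
  set A : Plane := !₂[1, 0] with hA_def
  set e : Plane := !₂[0, 1] with he_def
  have hA : IsIntegerPoint A := fun i => by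
    fin_cases i
    · exact ⟨1, by simp [hA_def]⟩
    · exact ⟨0, by simp [hA_def]⟩
  have he : IsIntegerPoint e := fun i => by
    fin_cases i
    · exact ⟨0, by simp [he_def]⟩
    · exact ⟨1, by simp [he_def]⟩
  have hdet : |planeDet A e| = 1 := by simp [planeDet, hA_def, he_def]
  have hd0 : planeDet A e ≠ 0 := fun h => by simp [h] at hdet
  have hne : Projectivization.mk ℝ (A + (0 : ℝ) • e) (add_smul_ne_zero hd0 0) ≠
      Projectivization.mk ℝ (A + (k : ℝ) • e) (add_smul_ne_zero hd0 k) := by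
    intro h
    obtain ⟨a, ha⟩ := (Projectivization.mk_eq_mk_iff' ℝ _ _ _ _).1 h
    have h0 := congrArg (fun z : Plane => z 0) ha
    have h1 := congrArg (fun z : Plane => z 1) ha
    simp [hA_def, he_def] at h0 h1
    rcases h1 with h1 | h1
    · rw [h0] at h1; exact one_ne_zero h1
    · exact hk.ne' h1
  have hself : ∀ s : ℝ, A + s • e ∈
      (Projectivization.mk ℝ (A + s • e) (add_smul_ne_zero hd0 s)).submodule := fun s => by
    rw [Projectivization.submodule_mk]
    exact Submodule.mem_span_singleton_self _
  refine ⟨A, A + (k : ℝ) • e, hA, hA.add (by exact_mod_cast he.zsmul k),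
    integerLength_primitive hA (isPrimitive_of_planeDet hA he hdet) hk,
    proj ⟨(_, _), hne⟩, (proj_mem_withEdge_iff hk hA he hdet _).2 (Or.inl ⟨?_, ?_⟩)⟩
  · exact ⟨0, by norm_num, hself 0⟩
  · exact ⟨k, by norm_num, hself k⟩

/-! ### Integrals of the Möbius density -/

/-- The density of the Möbius measure. -/
noncomputable def moebiusDensity (x y : ℝ) : ENNReal := ENNReal.ofReal (1 / |x - y| ^ 2)

theorem moebiusDensity_comm (x y : ℝ) : moebiusDensity x y = moebiusDensity y x := by
  unfold moebiusDensity
  rw [abs_sub_comm]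

theorem measurable_moebiusDensity : Measurable fun q : ℝ × ℝ => moebiusDensity q.1 q.2 := by
  unfold moebiusDensity
  simp only [sq_abs]
  fun_prop

theorem lintegral_Ioc_of_hasDerivAt {a b : ℝ} (hab : a ≤ b) {F f : ℝ → ℝ}
    (hF : ∀ x ∈ Icc a b, HasDerivAt F (f x) x) (hc : ContinuousOn f (Icc a b))
    (h0 : ∀ x ∈ Icc a b, 0 ≤ f x) :
    ∫⁻ x in Ioc a b, ENNReal.ofReal (f x) = ENNReal.ofReal (F b - F a) := by
  have hi : IntervalIntegrable f volume a b := hc.intervalIntegrable_of_Icc hab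
  rw [← ofReal_integral_eq_lintegral_ofReal
      ((intervalIntegrable_iff_integrableOn_Ioc_of_le hab).1 hi),
    ← intervalIntegral.integral_of_le hab,
    intervalIntegral.integral_eq_sub_of_hasDerivAt (by rwa [uIcc_of_le hab]) hi]
  filter_upwards [ae_restrict_mem measurableSet_Ioc] with x hx using h0 x (Ioc_subset_Icc_self hx)

theorem hasDerivAt_one_div_sub {u v : ℝ} (h : u < v) :
    HasDerivAt (fun v : ℝ => -(1 / (v - u))) (1 / |u - v| ^ 2) v := by
  have h1 : HasDerivAt (fun v : ℝ => v - u) 1 v := (hasDerivAt_id v).sub_const u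
  have h2 := (h1.inv (sub_pos.2 h).ne').neg
  have e1 : (fun v : ℝ => -(1 / (v - u))) = -(fun v : ℝ => v - u)⁻¹ := by
    ext v; simp
  rw [e1]
  refine h2.congr_deriv ?_
  rw [sq_abs, ← neg_sub v u, neg_sq]
  ring

theorem hasDerivAt_log_sub {c u : ℝ} (h : u < c) :
    HasDerivAt (fun u : ℝ => -Real.log (c - u)) (1 / (c - u)) u := by
  have h1 : HasDerivAt (fun u : ℝ => c - u) (-1) u := (hasDerivAt_id u).const_sub c
  have h2 := (h1.log (sub_pos.2 h).ne').neg
  refine h2.congr_deriv ?_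
  rw [neg_div, neg_neg]

theorem lintegral_moebiusDensity_Ico {u a b : ℝ} (hu : u < a) (hab : a ≤ b) :
    ∫⁻ v in Ico a b, moebiusDensity u v = ENNReal.ofReal (1 / (a - u) - 1 / (b - u)) := by
  unfold moebiusDensity
  rw [Measure.restrict_congr_set Ico_ae_eq_Ioc,
    lintegral_Ioc_of_hasDerivAt hab (F := fun v => -(1 / (v - u)))
      (fun v hv => hasDerivAt_one_div_sub (hu.trans_le hv.1)) ?_ (fun v _ => by positivity)]
  · congr 1
    ring
  · refine continuousOn_const.div (by fun_prop) fun v hv => ?_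
    have : u - v ≠ 0 := by linarith [hv.1]
    positivity

theorem lintegral_moebiusDensity_edge {k : ℕ} (hk : 0 < k) :
    ∫⁻ u in Ioc (-1 : ℝ) 0, ∫⁻ v in Ico (k : ℝ) (k + 1), moebiusDensity u v
      = ENNReal.ofReal (Real.log (((k : ℝ) + 1) ^ 2 / (k * (k + 2)))) := by
  have hk0 : (0 : ℝ) < k := by exact_mod_cast hk
  have h1 : ∀ u ∈ Ioc (-1 : ℝ) 0, ∫⁻ v in Ico (k : ℝ) (k + 1), moebiusDensity u v
      = ENNReal.ofReal (1 / (k - u) - 1 / (k + 1 - u)) := fun u hu =>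
    lintegral_moebiusDensity_Ico (by linarith [hu.2]) (by linarith)
  rw [setLIntegral_congr_fun measurableSet_Ioc h1,
    lintegral_Ioc_of_hasDerivAt (by norm_num)
      (F := fun u => -Real.log (k - u) - -Real.log (k + 1 - u))
      (fun u hu => (hasDerivAt_log_sub (by linarith [hu.2])).sub
        (hasDerivAt_log_sub (by linarith [hu.2])))]
  · congr 1
    rw [Real.log_div (by positivity) (by positivity), Real.log_pow,
      Real.log_mul (by positivity) (by positivity)]
    simp only [sub_zero, sub_neg_eq_add]
    rw [add_assoc (k : ℝ) 1 1, one_add_one_eq_two]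
    push_cast
    ring
  · refine ContinuousOn.sub ?_ ?_ <;>
      exact continuousOn_const.div (by fun_prop) fun u hu => by linarith [hu.2]
  · intro u hu
    exact sub_nonneg.2 (one_div_le_one_div_of_le (by linarith [hu.2]) (by linarith))

theorem lintegral_log_two :
    ∫⁻ q in Icc (-1 : ℝ) 0 ×ˢ Ici (1 : ℝ), ENNReal.ofReal (1 / (q.1 - q.2) ^ 2)
      = ENNReal.ofReal (Real.log 2) := by
  have hin : ∀ x ∈ Ioc (-1 : ℝ) 0, ∫⁻ y in Ici (1 : ℝ), ENNReal.ofReal (1 / (x - y) ^ 2)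
      = ENNReal.ofReal (1 / (1 - x)) := by
    intro x hx
    have hd : ∀ y ∈ Ici (1 : ℝ), HasDerivAt (fun y : ℝ => -(1 / (y - x))) (1 / (x - y) ^ 2) y := by
      intro y hy
      rw [← sq_abs]
      exact hasDerivAt_one_div_sub (by linarith [hx.2, mem_Ici.1 hy])
    have hpos : ∀ y ∈ Ioi (1 : ℝ), 0 ≤ 1 / (x - y) ^ 2 := fun y _ => by positivity
    have hlim : Tendsto (fun y : ℝ => -(1 / (y - x))) atTop (𝓝 0) := by
      have := (tendsto_inv_atTop_zero.comp (tendsto_atTop_add_const_right atTop (-x)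
        (tendsto_id (α := ℝ)))).neg
      simpa [Function.comp_def, sub_eq_add_neg] using this
    rw [← Measure.restrict_congr_set Ioi_ae_eq_Ici, ← ofReal_integral_eq_lintegral_ofReal
      (integrableOn_Ioi_deriv_of_nonneg' hd hpos hlim) (Eventually.of_forall fun y => by
        simp only [Pi.zero_apply]; positivity),
      integral_Ioi_of_hasDerivAt_of_nonneg' hd hpos hlim]
    congr 1
    ring
  rw [Measure.volume_eq_prod, setLIntegral_prod _ (by fun_prop),
    ← Measure.restrict_congr_set Ioc_ae_eq_Icc, setLIntegral_congr_fun measurableSet_Ioc hin,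
    lintegral_Ioc_of_hasDerivAt (by norm_num) (F := fun x => -Real.log (1 - x))
      (fun x hx => hasDerivAt_log_sub (by linarith [hx.2]))]
  · norm_num
  · exact continuousOn_const.div (by fun_prop) fun u hu => by linarith [hu.2]
  · intro u hu
    have : 0 < 1 - u := by linarith [hu.2]
    positivity

/-- The preimage of `I` under the fractional linear map `x ↦ (p + q x) / (r + s x)`. -/
def moebiusPreimage (p q r s : ℝ) (I : Set ℝ) : Set ℝ :=
  {x | r + s * x ≠ 0 ∧ (p + q * x) / (r + s * x) ∈ I}

theorem measurableSet_moebiusPreimage (p q r s : ℝ) {I : Set ℝ} (hI : MeasurableSet I) :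
    MeasurableSet (moebiusPreimage p q r s I) := by
  have h1 : Measurable fun x : ℝ => r + s * x := by fun_prop
  have h2 : Measurable fun x : ℝ => (p + q * x) / (r + s * x) := by fun_prop
  exact (h1 (measurableSet_singleton (0 : ℝ)).compl).inter (h2 hI)

theorem moebius_leftInverse {p q r s u : ℝ} (h : r * q - s * p ≠ 0) (hu : u * s - q ≠ 0) :
    r + s * ((p - u * r) / (u * s - q)) ≠ 0 ∧
      (p + q * ((p - u * r) / (u * s - q))) / (r + s * ((p - u * r) / (u * s - q))) = u := by
  have e1 : r + s * ((p - u * r) / (u * s - q)) = -(r * q - s * p) / (u * s - q) := by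
    rw [eq_div_iff hu, add_mul, mul_assoc, div_mul_cancel₀ _ hu]
    ring
  have e2 : p + q * ((p - u * r) / (u * s - q)) = u * (-(r * q - s * p) / (u * s - q)) := by
    rw [← mul_div_assoc u, eq_div_iff hu, add_mul, mul_assoc, div_mul_cancel₀ _ hu]
    ring
  have hne : -(r * q - s * p) / (u * s - q) ≠ 0 := div_ne_zero (neg_ne_zero.2 h) hu
  rw [e1, e2]
  exact ⟨hne, mul_div_cancel_right₀ _ hne⟩

theorem moebiusPreimage_eq_image {p q r s : ℝ} (h : r * q - s * p ≠ 0) (I : Set ℝ) :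
    moebiusPreimage p q r s I
      = (fun u => (p - u * r) / (u * s - q)) '' (I ∩ {u | u * s - q ≠ 0}) := by
  ext x
  constructor
  · rintro ⟨hx, hxI⟩
    have e1 : (p + q * x) / (r + s * x) * s - q = -(r * q - s * p) / (r + s * x) := by
      rw [eq_div_iff hx, sub_mul, mul_right_comm, div_mul_cancel₀ _ hx]
      ring
    have hne : (p + q * x) / (r + s * x) * s - q ≠ 0 := by
      rw [e1]
      exact div_ne_zero (neg_ne_zero.2 h) hx
    refine ⟨_, ⟨hxI, hne⟩, ?_⟩
    simp only
    rw [div_eq_iff hne, ← mul_left_inj' hx]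
    simp only [sub_mul, mul_sub]
    have e2 := div_mul_cancel₀ (p + q * x) hx
    linear_combination (-r - x * s) * e2
  · rintro ⟨u, ⟨huI, hu⟩, rfl⟩
    obtain ⟨h1, h2⟩ := moebius_leftInverse h hu
    exact ⟨h1, by rw [h2]; exact huI⟩

/-- Change of variables along the inverse map u ↦ (p - ur)/(us - q). The excluded u with us = q is
the image of x = ∞. -/
theorem lintegral_moebiusPreimage {p q r s : ℝ} (h : r * q - s * p ≠ 0) {I : Set ℝ}
    (hI : MeasurableSet I) (g : ℝ → ENNReal) :
    ∫⁻ x in moebiusPreimage p q r s I, g x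
      = ∫⁻ u in I ∩ {u | u * s - q ≠ 0}, ENNReal.ofReal (|r * q - s * p| / (u * s - q) ^ 2) *
        g ((p - u * r) / (u * s - q)) := by
  have hm : MeasurableSet (I ∩ {u : ℝ | u * s - q ≠ 0}) := by
    have h1 : Measurable fun u : ℝ => u * s - q := by fun_prop
    exact hI.inter (h1 (measurableSet_singleton (0 : ℝ)).compl)
  rw [moebiusPreimage_eq_image h, lintegral_image_eq_lintegral_abs_deriv_mul hm
    (f' := fun u => (r * q - s * p) / (u * s - q) ^ 2)]
  · refine setLIntegral_congr_fun hm fun u _ => ?_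
    simp only [abs_div, abs_pow, sq_abs]
  · rintro u ⟨-, hu⟩
    have h1 : HasDerivAt (fun u : ℝ => p - u * r) (-(1 * r)) u :=
      ((hasDerivAt_id u).mul_const r).const_sub p
    have h2 : HasDerivAt (fun u : ℝ => u * s - q) (1 * s) u :=
      ((hasDerivAt_id u).mul_const s).sub_const q
    have h3 := h1.div h2 hu
    refine HasDerivAt.hasDerivWithinAt ?_
    refine h3.congr_deriv ?_
    congr 1
    ring
  · rintro u ⟨-, hu⟩ v ⟨-, hv⟩ huv
    simp only at huv
    rw [← (moebius_leftInverse h hu).2, huv, (moebius_leftInverse h hv).2]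

/-- The Möbius density is invariant under fractional linear maps. -/
theorem lintegral_lintegral_moebiusPreimage {p q r s : ℝ} (h : r * q - s * p ≠ 0) {I J : Set ℝ}
    (hI : MeasurableSet I) (hJ : MeasurableSet J) (hIJ : Disjoint I J) :
    ∫⁻ x in moebiusPreimage p q r s I, ∫⁻ y in moebiusPreimage p q r s J, moebiusDensity x y
      = ∫⁻ u in I, ∫⁻ v in J, moebiusDensity u v := by
  have hnull : ∀ S : Set ℝ, (S ∩ {u : ℝ | u * s - q ≠ 0} : Set ℝ) =ᵐ[volume] S := by
    intro S
    have h0 : ∀ᵐ u : ℝ, u ≠ q / s := by simp [ae_iff, measure_singleton]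
    filter_upwards [h0] with u hu
    refine propext ⟨fun hx => hx.1, fun hx => ⟨hx, fun h1 => ?_⟩⟩
    by_cases hs : s = 0
    · subst hs
      apply h
      rw [mul_zero, zero_sub, neg_eq_zero] at h1
      simp [h1]
    · exact hu (by rw [eq_div_iff hs]; linarith)
  have hm : ∀ {S : Set ℝ}, MeasurableSet S → MeasurableSet (S ∩ {u : ℝ | u * s - q ≠ 0}) := by
    intro S hS
    have h1 : Measurable fun u : ℝ => u * s - q := by fun_prop
    exact hS.inter (h1 (measurableSet_singleton (0 : ℝ)).compl)
  simp only [lintegral_moebiusPreimage h hI, lintegral_moebiusPreimage h hJ]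
  rw [← Measure.restrict_congr_set (hnull I)]
  refine setLIntegral_congr_fun (hm hI) fun u hu => ?_
  rw [← lintegral_const_mul' _ _ ENNReal.ofReal_ne_top, ← Measure.restrict_congr_set (hnull J)]
  refine setLIntegral_congr_fun (hm hJ) fun v hv => ?_
  unfold moebiusDensity
  have hu' : u * s - q ≠ 0 := hu.2
  have hv' : v * s - q ≠ 0 := hv.2
  have huv : u - v ≠ 0 := sub_ne_zero.2 fun h => hIJ.le_bot ⟨hu.1, h ▸ hv.1⟩
  rw [← ENNReal.ofReal_mul (by positivity), ← ENNReal.ofReal_mul (by positivity)]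
  congr 1
  -- The difference x - y acquires the factor Δ/((us-q)(vs-q)) with Δ = rq - sp; its square is the
  -- product of the two Jacobians, up to sign, so they cancel in dx dy/(x-y)².
  have e1 : (p - u * r) / (u * s - q) - (p - v * r) / (v * s - q)
      = (r * q - s * p) * (u - v) / ((u * s - q) * (v * s - q)) := by
    rw [div_sub_div _ _ hu' hv']
    congr 1
    ring
  rw [e1, sq_abs, sq_abs, div_pow, mul_pow, mul_pow]
  generalize r * q - s * p = Δ at h
  generalize u * s - q = a at hu'
  generalize v * s - q = b at hv'
  have hΔ : |Δ| ≠ 0 := abs_ne_zero.2 h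
  rw [← sq_abs Δ]
  field_simp

/-! ### The relative frequency of an edge -/

/-- By Cramer's rule det(A,e) z = det(z,e) A + det(A,z) e, so the line through z meets A + se
exactly at s = det(A,z)/det(z,e), unless z is parallel to e. -/
theorem mk_mem_slopeSet_iff {A e : Plane} (hdet : planeDet A e ≠ 0) (I : Set ℝ) {z : Plane}
    (hz : z ≠ 0) : Projectivization.mk ℝ z hz ∈ slopeSet A e I ↔
      planeDet z e ≠ 0 ∧ planeDet A z / planeDet z e ∈ I := by
  simp only [slopeSet, mem_ofPred_eq, Projectivization.submodule_mk,
    Submodule.mem_span_singleton]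
  constructor
  · rintro ⟨s, hs, a, ha⟩
    have h1 : a * planeDet z e = planeDet A e := by
      have := congrArg (fun y => planeDet y e) ha
      simp [planeDet] at this ⊢
      linear_combination this
    have h2 : a * planeDet A z = s * planeDet A e := by
      have := congrArg (fun y => planeDet A y) ha
      simp [planeDet] at this ⊢
      linear_combination this
    have ha0 : a ≠ 0 := fun h => hdet (by rw [← h1, h, zero_mul])
    have hz0 : planeDet z e ≠ 0 := fun h => hdet (by rw [← h1, h, mul_zero])
    refine ⟨hz0, ?_⟩
    have : planeDet A z / planeDet z e = s := by
      rw [div_eq_iff hz0]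
      apply mul_left_cancel₀ ha0
      rw [h2, ← h1]
      ring
    rwa [this]
  · rintro ⟨h0, hI⟩
    refine ⟨_, hI, planeDet A e / planeDet z e, ?_⟩
    rw [div_eq_inv_mul, mul_smul, cramer, smul_add, inv_smul_smul₀ h0, smul_smul,
      ← div_eq_inv_mul]

theorem measurableSet_slopeSet {A e : Plane} (hdet : planeDet A e ≠ 0) {I : Set ℝ}
    (hI : MeasurableSet I) : MeasurableSet (slopeSet A e I) := by
  refine measurableSet_quotient.2 ?_
  have : (Quotient.mk'' ⁻¹' (slopeSet A e I) : Set {v : Plane // v ≠ 0})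
      = Subtype.val ⁻¹' ({z | planeDet z e ≠ 0} ∩ {z | planeDet A z / planeDet z e ∈ I}) := by
    ext ⟨z, hz⟩
    exact mk_mem_slopeSet_iff hdet I hz
  rw [this]
  have h1 : Measurable fun z : Plane => planeDet z e := by unfold planeDet; fun_prop
  have h2 : Measurable fun z : Plane => planeDet A z / planeDet z e := by
    unfold planeDet; fun_prop
  exact measurable_subtype_coe ((h1 (measurableSet_singleton (0 : ℝ)).compl).inter (h2 hI))

theorem CoordLine.measurable_lineThrough (l : CoordLine) : Measurable l.lineThrough := by
  have : Measurable fun t : ℝ =>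
      (⟨l.base + t • l.dir, l.avoids_origin t⟩ : {v : Plane // v ≠ 0}) :=
    Measurable.subtype_mk (by fun_prop)
  exact measurable_quotient_mk''.comp this

theorem CoordLine.measurable_framedOfCoords (l : CoordLine) : Measurable l.framedOfCoords :=
  Measurable.subtype_mk
    ((l.measurable_lineThrough.comp (measurable_fst.comp measurable_subtype_coe)).prodMk
      (l.measurable_lineThrough.comp (measurable_snd.comp measurable_subtype_coe)))

theorem measurable_proj : Measurable proj := measurable_quotient_mk''

/-- The slope is a quotient of two functions affine in the coordinate on l, so passing from the
chart of l to the parameter s is a fractional linear map. -/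
theorem CoordLine.lineThrough_mem_slopeSet_iff (l : CoordLine) {A e : Plane}
    (hdet : planeDet A e ≠ 0) (I : Set ℝ) (x : ℝ) :
    l.lineThrough x ∈ slopeSet A e I ↔ x ∈ moebiusPreimage (planeDet A l.base)
      (planeDet A l.dir) (planeDet l.base e) (planeDet l.dir e) I := by
  have e1 : planeDet (l.base + x • l.dir) e = planeDet l.base e + planeDet l.dir e * x := by
    simp [planeDet]; ring
  have e2 : planeDet A (l.base + x • l.dir) = planeDet A l.base + planeDet A l.dir * x := by
    simp [planeDet]; ring
  rw [CoordLine.lineThrough, mk_mem_slopeSet_iff hdet, e1, e2]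
  rfl

theorem CoordLine.planeDet_ne_zero (l : CoordLine) : planeDet l.dir l.base ≠ 0 := by
  intro h
  have hd : l.dir ≠ 0 := fun h0 => by simpa [h0] using l.norm_dir
  obtain ⟨r, hr⟩ := exists_smul_of_planeDet_eq_zero hd h
  exact l.avoids_origin (-r) (by rw [hr]; module)

theorem formMeasure_preimage {W : Set (ℝ × ℝ)} (hW : MeasurableSet W)
    (hd : ∀ q ∈ W, q.1 ≠ q.2) :
    formMeasure (Subtype.val ⁻¹' W) = ∫⁻ q in W, moebiusDensity q.1 q.2 := by
  have hm : MeasurableSet {q : ℝ × ℝ | q.1 ≠ q.2} :=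
    (measurableSet_eq_fun measurable_fst measurable_snd).compl
  unfold formMeasure
  rw [withDensity_apply _ (measurable_subtype_coe hW)]
  have := setLIntegral_subtype (μ := (volume : Measure (ℝ × ℝ))) hm (Subtype.val ⁻¹' W)
    fun q => moebiusDensity q.1 q.2
  rw [Subtype.image_preimage_coe, inter_eq_right.2 (show W ⊆ {q : ℝ × ℝ | q.1 ≠ q.2} from hd)]
    at this
  exact this

theorem relativeFrequency_edge (l : CoordLine) {A e : Plane} {k : ℕ} (hk : 0 < k)
    (hA : IsIntegerPoint A) (he : IsIntegerPoint e) (hdet : |planeDet A e| = 1) :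
    relativeFrequency l (segment ℝ A (A + (k : ℝ) • e))
      = ENNReal.ofReal (Real.log (((k : ℝ) + 1) ^ 2 / (k * (k + 2)))) := by
  have hk0 : (0 : ℝ) < k := by exact_mod_cast hk
  have hd0 : planeDet A e ≠ 0 := fun h => by simp [h] at hdet
  set S := slopeSet A e (Ioc (-1) 0)
  set T := slopeSet A e (Ico k (k + 1))
  have hS : MeasurableSet S := measurableSet_slopeSet hd0 measurableSet_Ioc
  have hT : MeasurableSet T := measurableSet_slopeSet hd0 measurableSet_Ico
  have hpre : proj ⁻¹' withEdge (segment ℝ A (A + (k : ℝ) • e))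
      = Subtype.val ⁻¹' (S ×ˢ T ∪ T ×ˢ S) := by
    ext c
    exact proj_mem_withEdge_iff hk hA he hdet c
  have hmE : MeasurableSet (withEdge (segment ℝ A (A + (k : ℝ) • e))) := by
    refine measurableSet_quotient.2 ?_
    change MeasurableSet (proj ⁻¹' _)
    rw [hpre]
    exact measurable_subtype_coe ((hS.prod hT).union (hT.prod hS))
  set Q := moebiusPreimage (planeDet A l.base) (planeDet A l.dir) (planeDet l.base e)
    (planeDet l.dir e) with hQ
  -- The determinant of the change of charts factors by the Plücker relation. It is nonzero since A,
  -- e is a basis and l misses the origin.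
  have hΔ : planeDet l.base e * planeDet A l.dir - planeDet l.dir e * planeDet A l.base ≠ 0 := by
    have : planeDet l.base e * planeDet A l.dir - planeDet l.dir e * planeDet A l.base
        = -planeDet A e * planeDet l.dir l.base := by
      unfold planeDet; ring
    rw [this]
    exact mul_ne_zero (neg_ne_zero.2 hd0) l.planeDet_ne_zero
  have hmI : MeasurableSet (Q (Ioc (-1) 0)) := measurableSet_moebiusPreimage _ _ _ _ measurableSet_Ioc
  have hmJ : MeasurableSet (Q (Ico k (k + 1))) :=
    measurableSet_moebiusPreimage _ _ _ _ measurableSet_Ico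
  have hIJ : Disjoint (Ioc (-1 : ℝ) 0) (Ico (k : ℝ) (k + 1)) :=
    Set.disjoint_left.2 fun u hu hv => by linarith [hu.2, hv.1]
  have hQd : Disjoint (Q (Ioc (-1) 0)) (Q (Ico k (k + 1))) :=
    Set.disjoint_left.2 fun x hx hy => Set.disjoint_left.1 hIJ hx.2 hy.2
  have hpre2 : l.framedOfCoords ⁻¹' (Subtype.val ⁻¹' (S ×ˢ T ∪ T ×ˢ S)) = Subtype.val ⁻¹'
      (Q (Ioc (-1) 0) ×ˢ Q (Ico k (k + 1)) ∪ Q (Ico k (k + 1)) ×ˢ Q (Ioc (-1) 0)) := by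
    ext q
    simp only [mem_preimage, CoordLine.framedOfCoords, mem_union, mem_prod, S, T, Q,
      l.lineThrough_mem_slopeSet_iff hd0]
  -- The two orderings of the pair of lines have equal measure, so their sum is twice the integral
  -- over one of them.
  have hsym : ∫⁻ q in Q (Ico k (k + 1)) ×ˢ Q (Ioc (-1) 0), moebiusDensity q.1 q.2
      = ∫⁻ q in Q (Ioc (-1) 0) ×ˢ Q (Ico k (k + 1)), moebiusDensity q.1 q.2 := by
    rw [Measure.volume_eq_prod, setLIntegral_prod _ measurable_moebiusDensity.aemeasurable,
      setLIntegral_prod_symm _ measurable_moebiusDensity.aemeasurable]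
    simp only [moebiusDensity_comm]
  have hval : ∫⁻ q in Q (Ioc (-1) 0) ×ˢ Q (Ico k (k + 1)), moebiusDensity q.1 q.2
      = ENNReal.ofReal (Real.log (((k : ℝ) + 1) ^ 2 / (k * (k + 2)))) := by
    rw [Measure.volume_eq_prod, setLIntegral_prod _ measurable_moebiusDensity.aemeasurable,
      ← lintegral_moebiusDensity_edge hk]
    exact lintegral_lintegral_moebiusPreimage hΔ measurableSet_Ioc measurableSet_Ico hIJ
  unfold relativeFrequency moebiusMeasure framedMoebiusMeasure
  rw [Measure.smul_apply, Measure.map_apply measurable_proj hmE, hpre,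
    Measure.map_apply l.measurable_framedOfCoords
      (measurable_subtype_coe ((hS.prod hT).union (hT.prod hS))), hpre2,
    formMeasure_preimage ((hmI.prod hmJ).union (hmJ.prod hmI)),
    lintegral_union (hmJ.prod hmI), hsym, hval, ← two_mul, smul_eq_mul, ← mul_assoc,
    ENNReal.inv_mul_cancel two_ne_zero ENNReal.ofNat_ne_top, one_mul]
  · exact Set.disjoint_left.2 fun q h1 h2 => Set.disjoint_left.1 hQd h1.1 h2.1
  · rintro q (h | h) heq
    · exact Set.disjoint_left.1 hQd h.1 (heq ▸ h.2)
    · exact Set.disjoint_left.1 hQd h.2 (heq ▸ h.1)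

end KleinCF

theorem mainTheorem4 :
    (∫⁻ q in Set.Icc (-1 : ℝ) 0 ×ˢ Set.Ici (1 : ℝ), ENNReal.ofReal (1 / (q.1 - q.2) ^ 2)
        = ENNReal.ofReal (Real.log 2)) ∧
    ∀ k : ℕ, 0 < k →
      ∃ P : ℝ, KleinCF.IsDigitFrequency k P ∧
        (∃ A B : KleinCF.Plane, KleinCF.IsIntegerPoint A ∧ KleinCF.IsIntegerPoint B ∧
          KleinCF.integerLength A B = (k : ℝ) ∧ (KleinCF.withEdge (segment ℝ A B)).Nonempty) ∧
        ∀ (l : KleinCF.CoordLine) (A B : KleinCF.Plane),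
          KleinCF.IsIntegerPoint A → KleinCF.IsIntegerPoint B →
          KleinCF.integerLength A B = (k : ℝ) → (KleinCF.withEdge (segment ℝ A B)).Nonempty →
          KleinCF.relativeFrequency l (segment ℝ A B) = ENNReal.ofReal (Real.log 2 * P) := by
  refine ⟨KleinCF.lintegral_log_two, fun k hk =>
    ⟨_, KleinCF.isDigitFrequency_log hk, KleinCF.exists_edge hk, fun l A B hA hB hl hne => ?_⟩⟩
  obtain ⟨e, he, hdet, rfl⟩ := KleinCF.exists_basis_of_edge hA hB hk hl hne
  rw [KleinCF.relativeFrequency_edge l hk hA he hdet,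
    mul_div_cancel₀ _ (Real.log_pos one_lt_two).ne']
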